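/- For every $\varepsilon>0$ there is an $N_0=N_0(\varepsilon)$ such that for all integers $N\ge N_0$ and all $A,B\subseteq\{1,\dots,N\}$ with $|A|,|B|\ge(\tfrac38+\varepsilon)N$, the sumset $A+B=\{a+b : a\in A,\ b\in B\}$ contains a perfect square. In fact, under the same assumptions, $$\#\{(a,b)\in A\times B : a+b \text{ is a perfect square}\}\ \ge\ 10^{-6}\,\varepsilon^{3}N^{3/2}.$$ The constant $\tfrac38$ is sharp: for every $\delta>0$ and all sufficiently large $N$ (depending on $\delta$) there exist $A,B\subseteq\{1,\dots,N\}$ with $|A|,|B|\ge(\tfrac38-\delta)N$ such that $A+B$ contains no perfect square. -/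

import Mathlib

open scoped Pointwise

/-! Squares are counted with a weight. The square n² gets 2n times a factor that doubles when 3
divides n; this spreads the mass evenly over the residues 0, 1, 4, 9 mod 12, that is, over residues
in {0, 1} both mod 4 and mod 3. The weighted squares (`sqKernel`) are compared with the function
equal to 3 on those residues (`sqModel`).

Write 1_A = f + α, where α is the density of A on each class mod 12, and likewise 1_B = g + β. The
weighted count of square sums is then a main term in α and β, cross terms with a periodic factor,
which are negligible because kernel and model agree on progressions mod 12 (`abs_sum_periodic_le`),
and the form Σ f(a) g(b) (kernel − model)(a + b).

The last form is bounded spectrally. On short windows the exponential sum of kernel − model is at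
most about half the window length (`norm_sum_window_le`): near fractions with denominator 12 the two
sums cancel; elsewhere the model sum is small and Weyl differencing bounds the square sum. Over the
whole range of a + b, of length 2N, a single supremum would give norm N; splitting into windows and
noting that each a meets only length about N of them gives N/2 (`abs_bilinear_sub_le`).

With N = 12L both the main term and the error are 3L² times finite expressions, and positivity
reduces to Σ_{r+s ∈ {0,1,4,9}} α_r β_s > Σ α_r(1 − α_r) + Σ β_r(1 − β_r) when both mean densities
exceed 3/8 (`mod_twelve_bound`). Averaging over mod 3 leaves a problem on the mod 4 classes, whose
edges r + s ∈ {0, 1} form an eight-cycle; minimising over one set leaves four variables on a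
four-cycle. Equality holds for the mod 4 densities of the mod 8 example that gives sharpness. -/

/-! ### The finite inequality modulo 12. -/

/-- The minimum of x² − 2(1 − c)x over x ≥ 0 is −(1 − c)₊². This eliminates one set's densities from
the eight-cycle form. -/
lemma sub_sq_posPart_le {c x : ℝ} (hx : 0 ≤ x) :
    x - (max (1 - c) 0) ^ 2 ≤ x ^ 2 + 2 * c * x - x := by
  rcases le_total (1 - c) 0 with h | h
  · rw [max_eq_right h]; nlinarith
  · rw [max_eq_left h]; nlinarith [sq_nonneg (x - (1 - c))]

/-- Call an edge of the cycle p, q, r, s deficient when its endpoints sum to less than 1. This lemma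
and the next four treat the possible sets of deficient edges up to symmetry. Equality occurs at (0,
0, 1/2, 1), in the adjacent case, so nothing may be lost there. -/
lemma fourCycle_bound_one {p q r s : ℝ} (hp : 0 ≤ p) (hq : 0 ≤ q)
    (hp1 : p ≤ 1) (hq1 : q ≤ 1) :
    p + q + r + s - 3 / 2 ≤ p ^ 2 + q ^ 2 + r ^ 2 + s ^ 2 - (1 - (p + q)) ^ 2 := by
  nlinarith [sq_nonneg (r - 1 / 2), sq_nonneg (s - 1 / 2), mul_nonneg hp (sub_nonneg.2 hq1),
    mul_nonneg hq (sub_nonneg.2 hp1)]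

lemma fourCycle_bound_opposite {p q r s : ℝ} (h1 : p + q ≤ 1) (h3 : r + s ≤ 1)
    (hT : 3 / 2 ≤ p + q + r + s) :
    p + q + r + s - 3 / 2 ≤ p ^ 2 + q ^ 2 + r ^ 2 + s ^ 2
      - (1 - (p + q)) ^ 2 - (1 - (r + s)) ^ 2 := by
  nlinarith [sq_nonneg (p - q), sq_nonneg (r - s), mul_nonneg (sub_nonneg.2 h1) (sub_nonneg.2 h3)]

lemma fourCycle_bound_adjacent {p q r s : ℝ} (hq : 0 ≤ q)
    (h1 : p + q ≤ 1) (h2 : q + r ≤ 1) (hT : 3 / 2 ≤ p + q + r + s) :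
    p + q + r + s - 3 / 2 ≤ p ^ 2 + q ^ 2 + r ^ 2 + s ^ 2
      - (1 - (p + q)) ^ 2 - (1 - (q + r)) ^ 2 := by
  rcases le_total q (1 / 2) with h | h
  · have : 0 ≤ (p + r - (3 / 2 - q - s)) * (1 - 2 * q) :=
      mul_nonneg (by linarith) (by linarith)
    nlinarith [sq_nonneg (s - (1 - q))]
  · have : 0 ≤ (2 - 2 * q - (p + r)) * (2 * q - 1) := mul_nonneg (by linarith) (by linarith)
    nlinarith [sq_nonneg (s - 1 / 2), sq_nonneg (q - 1 / 2)]

lemma fourCycle_bound_three {p q r s : ℝ} (hq : 0 ≤ q) (hr : 0 ≤ r)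
    (h1 : p + q ≤ 1) (h2 : q + r ≤ 1) (h3 : r + s ≤ 1) (hT : 3 / 2 ≤ p + q + r + s) :
    p + q + r + s - 3 / 2 ≤ p ^ 2 + q ^ 2 + r ^ 2 + s ^ 2
      - (1 - (p + q)) ^ 2 - (1 - (q + r)) ^ 2 - (1 - (r + s)) ^ 2 := by
  rcases le_total q r with hqr | hqr
  · rcases le_total r (1 / 2) with h | h
    · have e1 : 0 ≤ (p + q - 1 / 2) * (r - q) := mul_nonneg (by linarith) (by linarith)
      have e2 : 0 ≤ (p + q + r + s - 3 / 2) * (1 - 2 * r) := mul_nonneg (by linarith) (by linarith)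
      nlinarith [sq_nonneg (q - r)]
    · have e1 : 0 ≤ (p + q - 1 / 2) * (1 - 2 * q) := mul_nonneg (by linarith) (by linarith)
      have e2 : 0 ≤ (1 - (r + s)) * (2 * r - 1) := mul_nonneg (by linarith) (by linarith)
      nlinarith [sq_nonneg (q - r)]
  · rcases le_total q (1 / 2) with h | h
    · have e1 : 0 ≤ (s + r - 1 / 2) * (q - r) := mul_nonneg (by linarith) (by linarith)
      have e2 : 0 ≤ (p + q + r + s - 3 / 2) * (1 - 2 * q) := mul_nonneg (by linarith) (by linarith)
      nlinarith [sq_nonneg (q - r)]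
    · have e1 : 0 ≤ (s + r - 1 / 2) * (1 - 2 * r) := mul_nonneg (by linarith) (by linarith)
      have e2 : 0 ≤ (1 - (p + q)) * (2 * q - 1) := mul_nonneg (by linarith) (by linarith)
      nlinarith [sq_nonneg (q - r)]

lemma fourCycle_bound_four {p q r s : ℝ} (h1 : p + q ≤ 1) (h2 : q + r ≤ 1) (h3 : r + s ≤ 1)
    (h4 : s + p ≤ 1) (hT : 3 / 2 ≤ p + q + r + s) :
    p + q + r + s - 3 / 2 ≤ p ^ 2 + q ^ 2 + r ^ 2 + s ^ 2
      - (1 - (p + q)) ^ 2 - (1 - (q + r)) ^ 2 - (1 - (r + s)) ^ 2 - (1 - (s + p)) ^ 2 := by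
  -- The product of the slacks of opposite edges is nonnegative; the two products add up to this
  -- bound.
  have hd : (p - r) ^ 2 + (q - s) ^ 2 ≤ (2 - (p + q + r + s)) ^ 2 := by
    have a : 0 ≤ (1 - (p + q)) * (1 - (r + s)) := mul_nonneg (by linarith) (by linarith)
    have b : 0 ≤ (1 - (q + r)) * (1 - (s + p)) := mul_nonneg (by linarith) (by linarith)
    nlinarith
  have hT2 : p + q + r + s ≤ 2 := by linarith
  nlinarith [sq_nonneg (p + r - q - s), mul_nonneg (sub_nonneg.2 hT) (sub_nonneg.2 hT2)]

/-- A lower bound for a four-variable function arising from the four-cycle. -/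
lemma fourCycle_posPart_bound {p q r s : ℝ} (hp : 0 ≤ p) (hq : 0 ≤ q) (hr : 0 ≤ r) (hs : 0 ≤ s)
    (hp1 : p ≤ 1) (hq1 : q ≤ 1) (hr1 : r ≤ 1) (hs1 : s ≤ 1) (hT : 3 / 2 ≤ p + q + r + s) :
    p + q + r + s - 3 / 2 ≤ p ^ 2 + q ^ 2 + r ^ 2 + s ^ 2
      - (max (1 - (p + q)) 0) ^ 2 - (max (1 - (q + r)) 0) ^ 2
      - (max (1 - (r + s)) 0) ^ 2 - (max (1 - (s + p)) 0) ^ 2 := by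
  -- Sixteen patterns of deficient edges; rotations and reflections of the cycle reduce them to
  -- none, one, two opposite, two adjacent, three or four.
  rcases le_total (1 - (p + q)) 0 with h1 | h1 <;> rcases le_total (1 - (q + r)) 0 with h2 | h2 <;>
  rcases le_total (1 - (r + s)) 0 with h3 | h3 <;> rcases le_total (1 - (s + p)) 0 with h4 | h4 <;>
  simp only [max_eq_right h1, max_eq_right h2, max_eq_right h3, max_eq_right h4,
    max_eq_left h1, max_eq_left h2, max_eq_left h3, max_eq_left h4]
  · linarith [sq_nonneg (p - 1 / 2), sq_nonneg (q - 1 / 2), sq_nonneg (r - 1 / 2),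
      sq_nonneg (s - 1 / 2)]
  · linarith [fourCycle_bound_one (r := q) (s := r) hs hp hs1 hp1]
  · linarith [fourCycle_bound_one (r := p) (s := q) hr hs hr1 hs1]
  · linarith [fourCycle_bound_adjacent (p := r) (r := p) (s := q) hs
      (by linarith) (by linarith) (by linarith)]
  · linarith [fourCycle_bound_one (r := s) (s := p) hq hr hq1 hr1]
  · linarith [fourCycle_bound_opposite (p := q) (q := r) (r := s) (s := p)
      (by linarith) (by linarith) (by linarith)]
  · linarith [fourCycle_bound_adjacent (p := q) (r := s) (s := p) hr
      (by linarith) (by linarith) (by linarith)]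
  · linarith [fourCycle_bound_three (p := q) (q := r) (r := s) (s := p) hr hs
      (by linarith) (by linarith) (by linarith) (by linarith)]
  · linarith [fourCycle_bound_one (r := r) (s := s) hp hq hp1 hq1]
  · linarith [fourCycle_bound_adjacent (p := s) (r := q) (s := r) hp
      (by linarith) (by linarith) (by linarith)]
  · linarith [fourCycle_bound_opposite (p := p) (q := q) (r := r) (s := s)
      (by linarith) (by linarith) (by linarith)]
  · linarith [fourCycle_bound_three (p := r) (q := s) (r := p) (s := q) hs hp
      (by linarith) (by linarith) (by linarith) (by linarith)]
  · linarith [fourCycle_bound_adjacent (p := p) (r := r) (s := s) hq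
      (by linarith) (by linarith) (by linarith)]
  · linarith [fourCycle_bound_three (p := s) (q := p) (r := q) (s := r) hp hq
      (by linarith) (by linarith) (by linarith) (by linarith)]
  · linarith [fourCycle_bound_three (p := p) (q := q) (r := r) (s := s) hq hr
      (by linarith) (by linarith) (by linarith) (by linarith)]
  · linarith [fourCycle_bound_four (p := p) (q := q) (r := r) (s := s)
      (by linarith) (by linarith) (by linarith) (by linarith) (by linarith)]

/-- The eight-cycle inequality: densities on the residue classes modulo `4` of two sets whose mean
densities exceed `3 / 8` see more sums in `{0, 1}` than the spectral error term. -/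
lemma eightCycle_aux {a0 a1 a2 a3 b0 b1 b2 b3 : ℝ}
    (ha0 : 0 ≤ a0) (ha1 : 0 ≤ a1) (ha2 : 0 ≤ a2) (ha3 : 0 ≤ a3)
    (hb0 : b0 ∈ Set.Icc (0 : ℝ) 1) (hb1 : b1 ∈ Set.Icc (0 : ℝ) 1) (hb2 : b2 ∈ Set.Icc (0 : ℝ) 1)
    (hb3 : b3 ∈ Set.Icc (0 : ℝ) 1) (hT : 3 / 2 ≤ b0 + b1 + b2 + b3)
    (hST : b0 + b1 + b2 + b3 ≤ a0 + a1 + a2 + a3) :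
    b0 + b1 + b2 + b3 - 3 / 2 ≤
      2 * (a0 * (b0 + b1) + a1 * (b3 + b0) + a2 * (b2 + b3) + a3 * (b1 + b2))
      - (a0 * (1 - a0) + a1 * (1 - a1) + a2 * (1 - a2) + a3 * (1 - a3))
      - (b0 * (1 - b0) + b1 * (1 - b1) + b2 * (1 - b2) + b3 * (1 - b3)) := by
  have h := fourCycle_posPart_bound hb0.1 hb1.1 hb2.1 hb3.1 hb0.2 hb1.2 hb2.2 hb3.2 hT
  linarith [sub_sq_posPart_le (c := b0 + b1) ha0, sub_sq_posPart_le (c := b3 + b0) ha1,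
    sub_sq_posPart_le (c := b2 + b3) ha2, sub_sq_posPart_le (c := b1 + b2) ha3]

/-- The form is symmetric under exchanging the two sets, so the set of larger total density can be
the one that is minimised out. -/
lemma eightCycle_bound {t a0 a1 a2 a3 b0 b1 b2 b3 : ℝ}
    (ha0 : a0 ∈ Set.Icc (0 : ℝ) 1) (ha1 : a1 ∈ Set.Icc (0 : ℝ) 1) (ha2 : a2 ∈ Set.Icc (0 : ℝ) 1)
    (ha3 : a3 ∈ Set.Icc (0 : ℝ) 1)
    (hb0 : b0 ∈ Set.Icc (0 : ℝ) 1) (hb1 : b1 ∈ Set.Icc (0 : ℝ) 1) (hb2 : b2 ∈ Set.Icc (0 : ℝ) 1)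
    (hb3 : b3 ∈ Set.Icc (0 : ℝ) 1) (ht : 0 ≤ t) (hS : 3 / 2 + t ≤ a0 + a1 + a2 + a3)
    (hT : 3 / 2 + t ≤ b0 + b1 + b2 + b3) :
    t ≤ 2 * (a0 * (b0 + b1) + a1 * (b3 + b0) + a2 * (b2 + b3) + a3 * (b1 + b2))
      - (a0 * (1 - a0) + a1 * (1 - a1) + a2 * (1 - a2) + a3 * (1 - a3))
      - (b0 * (1 - b0) + b1 * (1 - b1) + b2 * (1 - b2) + b3 * (1 - b3)) := by
  rcases le_total (b0 + b1 + b2 + b3) (a0 + a1 + a2 + a3) with h | h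
  · linarith [eightCycle_aux ha0.1 ha1.1 ha2.1 ha3.1 hb0 hb1 hb2 hb3 (by linarith) h]
  · linarith [eightCycle_aux hb0.1 hb1.1 hb2.1 hb3.1 ha0 ha1 ha2 ha3 (by linarith) h]

/-- Passing from densities modulo `12` to densities modulo `4` in the product over the
classes modulo `3`. -/
lemma mod_three_bound (x y z u v w : ℝ) :
    2 / 3 * (x + y + z) * (u + v + w)
      - 1 / 2 * (x ^ 2 + y ^ 2 + z ^ 2 - (x + y + z) ^ 2 / 3)
      - 1 / 2 * (u ^ 2 + v ^ 2 + w ^ 2 - (u + v + w) ^ 2 / 3)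
      ≤ x * (u + v) + y * (w + u) + z * (v + w) := by
  -- The right side is (x + y + z)(u + v + w) − (xw + yv + zu); AM-GM is applied to the centred part
  -- of the subtracted term.
  nlinarith [sq_nonneg (x - (x + y + z) / 3 - (w - (u + v + w) / 3)),
    sq_nonneg (y - (x + y + z) / 3 - (v - (u + v + w) / 3)),
    sq_nonneg (z - (x + y + z) / 3 - (u - (u + v + w) / 3))]

/-- The finite inequality modulo `12` behind the constant `3 / 8`. -/
lemma mod_twelve_bound {t : ℝ} (α β : ℕ → ℝ) (hα : ∀ r, α r ∈ Set.Icc (0 : ℝ) 1)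
    (hβ : ∀ r, β r ∈ Set.Icc (0 : ℝ) 1) (ht : 0 ≤ t)
    (hS : 9 / 2 + 3 * t ≤ ∑ r ∈ Finset.range 12, α r)
    (hT : 9 / 2 + 3 * t ≤ ∑ r ∈ Finset.range 12, β r) :
    3 * t ≤ (∑ r ∈ Finset.range 12, ∑ s ∈ Finset.range 12,
        if (r + s) % 12 ∈ ({0, 1, 4, 9} : Finset ℕ) then α r * β s else 0)
      - (∑ r ∈ Finset.range 12, α r * (1 - α r)) - ∑ r ∈ Finset.range 12, β r * (1 - β r) := by
  have key : ∀ (γ : ℕ → ℝ), (∀ r, γ r ∈ Set.Icc (0 : ℝ) 1) → ∀ i j k,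
      (γ i + γ j + γ k) / 3 ∈ Set.Icc (0 : ℝ) 1 := fun γ h i j k =>
    ⟨by linarith [(h i).1, (h j).1, (h k).1], by linarith [(h i).2, (h j).2, (h k).2]⟩
  simp only [Finset.sum_range_succ, Finset.sum_range_zero] at hS hT
  -- The triples are the classes mod 4, each listed in the order 0, 1, 2 mod 3 that
  -- `mod_three_bound` expects.
  have h := eightCycle_bound (key α hα 0 4 8) (key α hα 9 1 5) (key α hα 6 10 2) (key α hα 3 7 11)
    (key β hβ 0 4 8) (key β hβ 9 1 5) (key β hβ 6 10 2) (key β hβ 3 7 11) ht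
    (by linarith) (by linarith)
  have m := fun i j k i' j' k' => mod_three_bound (α i) (α j) (α k) (β i') (β j') (β k')
  simp only [Finset.sum_range_succ, Finset.sum_range_zero]
  norm_num
  -- These are the eight edges of the mod 4 cycle. Each class lies on two of them, so its half
  -- variances add up to one variance, which turns Σ α(1 − α) over the triple into 3ā(1 − ā).
  linarith [m 0 4 8 0 4 8, m 0 4 8 9 1 5, m 9 1 5 0 4 8, m 9 1 5 3 7 11, m 6 10 2 6 10 2,
    m 6 10 2 3 7 11, m 3 7 11 6 10 2, m 3 7 11 9 1 5]

/-! ### The additive character and geometric sums. -/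

/-- The additive character `x ↦ exp (2 π i x)` of the reals. -/
noncomputable def expChar (x : ℝ) : ℂ := Complex.exp (2 * Real.pi * x * Complex.I)

lemma expChar_eq_exp (x : ℝ) : expChar x = Complex.exp ((2 * Real.pi * x : ℝ) * Complex.I) := by
  simp [expChar]

lemma expChar_add (x y : ℝ) : expChar (x + y) = expChar x * expChar y := by
  rw [expChar, expChar, expChar, ← Complex.exp_add]
  push_cast; ring_nf

lemma expChar_zero : expChar 0 = 1 := by simp [expChar]

lemma norm_expChar (x : ℝ) : ‖expChar x‖ = 1 := by
  rw [expChar_eq_exp, Complex.norm_exp_ofReal_mul_I]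

lemma expChar_int (m : ℤ) : expChar m = 1 := by
  rw [expChar, Complex.exp_eq_one_iff]
  exact ⟨m, by push_cast; ring⟩

lemma expChar_add_int (x : ℝ) (m : ℤ) : expChar (x + m) = expChar x := by
  rw [expChar_add, expChar_int, mul_one]

lemma conj_expChar (x : ℝ) : (starRingEnd ℂ) (expChar x) = expChar (-x) := by
  rw [expChar_eq_exp, expChar_eq_exp, ← Complex.exp_conj]
  congr 1
  simp only [map_mul, Complex.conj_ofReal, Complex.conj_I]
  push_cast; ring

lemma expChar_nat_mul (n : ℕ) (x : ℝ) : expChar (n * x) = expChar x ^ n := by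
  induction n with
  | zero => simp [expChar_zero]
  | succ n ih => rw [pow_succ, ← ih, ← expChar_add]; push_cast; ring_nf

lemma norm_expChar_sub_one (x : ℝ) : ‖expChar x - 1‖ = 2 * |Real.sin (Real.pi * x)| := by
  rw [expChar_eq_exp, mul_comm, Complex.norm_exp_I_mul_ofReal_sub_one, Real.norm_eq_abs, abs_mul, abs_two]
  ring_nf

lemma norm_expChar_sub_one_le (x : ℝ) : ‖expChar x - 1‖ ≤ 2 * Real.pi * |x| := by
  rw [norm_expChar_sub_one]
  have := Real.abs_sin_le_abs (x := Real.pi * x)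
  rw [abs_mul, abs_of_pos Real.pi_pos] at this
  linarith

/-- If `x` is at distance at least `κ` from every integer then `expChar x` is far from `1`. -/
lemma le_norm_expChar_sub_one {x κ : ℝ} (h : ∀ p : ℤ, κ ≤ |x - p|) :
    4 * κ ≤ ‖expChar x - 1‖ := by
  have h1 := h (round x)
  have h2 : expChar x = expChar (x - round x) := by
    rw [← expChar_add_int (x - round x) (round x)]; simp
  have h3 := abs_sub_round x
  rw [h2, norm_expChar_sub_one]
  set y := x - round x
  rw [Real.abs_sin_eq_sin_abs_of_abs_le_pi]
  · rw [abs_mul, abs_of_pos Real.pi_pos]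
    have := Real.mul_le_sin (x := Real.pi * |y|) (by positivity)
      (by nlinarith [Real.pi_pos])
    have e : 2 / Real.pi * (Real.pi * |y|) = 2 * |y| := by field_simp
    linarith
  · rw [abs_mul, abs_of_pos Real.pi_pos]
    nlinarith [Real.pi_pos]

lemma norm_sum_range_expChar_le {x κ : ℝ} (hκ : 0 < κ) (h : ∀ p : ℤ, κ ≤ |x - p|) (n : ℕ) :
    ‖∑ i ∈ Finset.range n, expChar (i * x)‖ ≤ 1 / (2 * κ) := by
  have h1 := le_norm_expChar_sub_one h
  have h0 : expChar x ≠ 1 := by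
    intro h0
    rw [h0] at h1; simp at h1; linarith
  simp_rw [expChar_nat_mul]
  rw [geom_sum_eq h0, norm_div, div_le_div_iff₀ (by linarith) (by positivity)]
  have : ‖expChar x ^ n - 1‖ ≤ 2 := by
    refine (norm_sub_le _ _).trans ?_
    rw [norm_pow, norm_expChar]; norm_num
  nlinarith

/-! ### Weyl differencing for quadratic exponential sums. -/

/-- Expanding the square of a sum according to differences of indices. -/
lemma normSq_sum_range_eq (z : ℕ → ℂ) (M : ℕ) :
    ‖∑ n ∈ Finset.range M, z n‖ ^ 2 = ∑ n ∈ Finset.range M, ‖z n‖ ^ 2 +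
      2 * (∑ d ∈ Finset.Ico 1 M, ∑ n ∈ Finset.range (M - d),
        z (n + d) * (starRingEnd ℂ) (z n)).re := by
  induction M with
  | zero => simp
  | succ M ih =>
    have hsplit : ∑ d ∈ Finset.Ico 1 (M + 1), ∑ n ∈ Finset.range (M + 1 - d),
        z (n + d) * (starRingEnd ℂ) (z n) =
        (∑ d ∈ Finset.Ico 1 M, ∑ n ∈ Finset.range (M - d), z (n + d) * (starRingEnd ℂ) (z n)) +
        z M * (starRingEnd ℂ) (∑ n ∈ Finset.range M, z n) := by
      have e1 : ∀ d ∈ Finset.Ico 1 (M + 1), ∑ n ∈ Finset.range (M + 1 - d),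
          z (n + d) * (starRingEnd ℂ) (z n) = ∑ n ∈ Finset.range (M - d),
          z (n + d) * (starRingEnd ℂ) (z n) + z M * (starRingEnd ℂ) (z (M - d)) := by
        intro d hd
        rw [Finset.mem_Ico] at hd
        rw [show M + 1 - d = (M - d) + 1 by omega, Finset.sum_range_succ,
          show M - d + d = M by omega]
      rw [Finset.sum_congr rfl e1, Finset.sum_add_distrib]
      congr 1
      · rcases Nat.eq_zero_or_pos M with rfl | h
        · simp
        · rw [Finset.sum_Ico_succ_top (by omega)]; simp
      · rw [map_sum, Finset.mul_sum]
        refine Finset.sum_nbij' (fun d => M - d) (fun n => M - n) ?_ ?_ ?_ ?_ ?_ <;>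
          intro d hd <;> simp only [Finset.mem_Ico, Finset.mem_range] at * <;> omega
    rw [Finset.sum_range_succ, Finset.sum_range_succ, hsplit, Complex.add_re]
    have hn : ∀ u v : ℂ, ‖u + v‖ ^ 2 = ‖u‖ ^ 2 + ‖v‖ ^ 2 + 2 * (v * (starRingEnd ℂ) u).re := by
      intro u v
      rw [← Complex.normSq_eq_norm_sq, ← Complex.normSq_eq_norm_sq, ← Complex.normSq_eq_norm_sq,
        Complex.normSq_add, ← Complex.conj_re]
      simp [mul_comm]
    rw [hn, ih]
    ring

lemma normSq_sum_range_le (z : ℕ → ℂ) (M : ℕ) :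
    ‖∑ n ∈ Finset.range M, z n‖ ^ 2 ≤ ∑ n ∈ Finset.range M, ‖z n‖ ^ 2 +
      2 * ∑ d ∈ Finset.Ico 1 M, ‖∑ n ∈ Finset.range (M - d),
        z (n + d) * (starRingEnd ℂ) (z n)‖ := by
  rw [normSq_sum_range_eq]
  gcongr
  exact (Complex.re_le_norm _).trans (norm_sum_le _ _)

/-- The correlations of the quadratic phase at distance `d`. -/
lemma norm_correlation_eq (θ : ℝ) (n₀ d L : ℕ) :
    ‖∑ n ∈ Finset.range L, expChar (((n₀ + (n + d) : ℕ) : ℝ) ^ 2 * θ) *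
        (starRingEnd ℂ) (expChar (((n₀ + n : ℕ) : ℝ) ^ 2 * θ))‖ =
      ‖∑ n ∈ Finset.range L, expChar (n * (2 * d * θ))‖ := by
  have : ∀ n ∈ Finset.range L, expChar (((n₀ + (n + d) : ℕ) : ℝ) ^ 2 * θ) *
        (starRingEnd ℂ) (expChar (((n₀ + n : ℕ) : ℝ) ^ 2 * θ)) =
      expChar ((2 * n₀ * d + d ^ 2) * θ) * expChar (n * (2 * d * θ)) := by
    intro n _
    rw [conj_expChar, ← expChar_add, ← expChar_add]
    congr 1
    push_cast; ring
  rw [Finset.sum_congr rfl this, ← Finset.mul_sum, norm_mul, norm_expChar, one_mul]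

open Classical in
/-- Weyl differencing: a sum of quadratic phases is controlled by the shifts `d` for which `2dθ` is
close to an integer. -/
lemma weyl_differencing {θ κ : ℝ} (hκ : 0 < κ) (n₀ M : ℕ) :
    ‖∑ n ∈ Finset.range M, expChar (((n₀ + n : ℕ) : ℝ) ^ 2 * θ)‖ ^ 2 ≤
      M + M / κ + 2 * ∑ d ∈ (Finset.Ico 1 M).filter (fun d : ℕ => ∃ p : ℤ, |2 * d * θ - p| ≤ κ),
        ((M - d : ℕ) : ℝ) := by
  refine (normSq_sum_range_le _ M).trans ?_
  have h1 : ∑ n ∈ Finset.range M, ‖expChar (((n₀ + n : ℕ) : ℝ) ^ 2 * θ)‖ ^ 2 = M := by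
    simp [norm_expChar]
  rw [h1]
  simp_rw [norm_correlation_eq]
  rw [← Finset.sum_filter_add_sum_filter_not (Finset.Ico 1 M)
    (fun d : ℕ => ∃ p : ℤ, |2 * d * θ - p| ≤ κ)]
  have h2 : ∑ d ∈ (Finset.Ico 1 M).filter (fun d : ℕ => ¬ ∃ p : ℤ, |2 * d * θ - p| ≤ κ),
      ‖∑ n ∈ Finset.range (M - d), expChar (n * (2 * d * θ))‖ ≤ M * (1 / (2 * κ)) := by
    refine (Finset.sum_le_card_nsmul _ _ (1 / (2 * κ)) ?_).trans ?_
    · intro d hd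
      rw [Finset.mem_filter] at hd
      have h := hd.2
      push Not at h
      exact norm_sum_range_expChar_le hκ (fun p => (h p).le) _
    · rw [nsmul_eq_mul]
      gcongr
      refine (Finset.card_filter_le _ _).trans ?_
      simp
  have h3 : ∑ d ∈ (Finset.Ico 1 M).filter (fun d : ℕ => ∃ p : ℤ, |2 * d * θ - p| ≤ κ),
      ‖∑ n ∈ Finset.range (M - d), expChar (n * (2 * d * θ))‖ ≤
      ∑ d ∈ (Finset.Ico 1 M).filter (fun d : ℕ => ∃ p : ℤ, |2 * d * θ - p| ≤ κ),
        ((M - d : ℕ) : ℝ) := by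
    refine Finset.sum_le_sum fun d _ => (norm_sum_le _ _).trans ?_
    simp [norm_expChar]
  have e : (M : ℝ) / κ = 2 * (M * (1 / (2 * κ))) := by field_simp
  rw [e]
  linarith

/-- A `q`-separated subset of `[1, M)` with least element at least `q`. -/
lemma sum_sub_le_of_separated {q M : ℕ} {D : Finset ℕ} (hD : D ⊆ Finset.Ico 1 M)
    (h0 : ∀ d ∈ D, q ≤ d) (hsep : ∀ d ∈ D, ∀ d' ∈ D, d < d' → q ≤ d' - d) :
    2 * q * ∑ d ∈ D, ((M - d : ℕ) : ℝ) ≤ (M : ℝ) ^ 2 := by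
  -- The blocks (d − q, d] are disjoint subsets of [1, M), and M − e ≥ M − d on the block of d.
  have hinj : Set.InjOn (fun x : ℕ × ℕ => x.1 - x.2) (D ×ˢ Finset.range q : Finset (ℕ × ℕ)) := by
    rintro ⟨d, i⟩ h ⟨d', i'⟩ h' e
    simp only [Finset.coe_product, Set.mem_prod, Finset.mem_coe, Finset.mem_range] at h h' e
    have a := h0 d h.1
    have a' := h0 d' h'.1
    have : d = d' := by
      rcases lt_trichotomy d d' with c | c | c
      · have := hsep d h.1 d' h'.1 c; omega
      · exact c
      · have := hsep d' h'.1 d h.1 c; omega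
    subst this
    ext <;> simp; omega
  have h1 : ∑ x ∈ D ×ˢ Finset.range q, (M - (x.1 - x.2)) ≤ ∑ e ∈ Finset.Ico 1 M, (M - e) := by
    rw [← Finset.sum_image (f := fun e => M - e) hinj]
    refine Finset.sum_le_sum_of_subset fun e he => ?_
    rw [Finset.mem_image] at he
    obtain ⟨⟨d, i⟩, h, rfl⟩ := he
    simp only [Finset.mem_product, Finset.mem_range] at h
    have a := h0 d h.1
    have b := Finset.mem_Ico.1 (hD h.1)
    simp only [Finset.mem_Ico]; omega
  have h2 : q * ∑ d ∈ D, (M - d) ≤ ∑ x ∈ D ×ˢ Finset.range q, (M - (x.1 - x.2)) := by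
    rw [Finset.sum_product, Finset.mul_sum]
    refine Finset.sum_le_sum fun d _ => ?_
    calc q * (M - d) = ∑ _i ∈ Finset.range q, (M - d) := by simp
      _ ≤ _ := Finset.sum_le_sum fun i _ => by simp only; omega
  have h3 : 2 * ∑ e ∈ Finset.Ico 1 M, (M - e) ≤ M ^ 2 := by
    clear h1 h2 hinj hsep h0 hD
    have : ∑ e ∈ Finset.Ico 1 M, (M - e) = ∑ e ∈ Finset.range M, e := by
      refine (Finset.sum_nbij' (t := Finset.Ico 1 M) (g := fun e => e) (fun e => M - e) (fun e => M - e) ?_ ?_ ?_ ?_ ?_).trans ?_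
      · intro d hd; simp only [Finset.mem_Ico] at *; omega
      · intro d hd; simp only [Finset.mem_Ico] at *; omega
      · intro d hd; simp only [Finset.mem_Ico] at *; omega
      · intro d hd; simp only [Finset.mem_Ico] at *; omega
      · intro d hd; rfl
      · rcases Nat.eq_zero_or_pos M with rfl | h
        · simp
        · rw [Finset.range_eq_Ico, Finset.sum_eq_sum_Ico_succ_bot h]; simp
    rw [this, mul_comm, Finset.sum_range_id_mul_two]
    rcases M with _ | M
    · simp
    · simp; nlinarith
  have h4 : 2 * q * ∑ d ∈ D, (M - d) ≤ M ^ 2 := by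
    calc _ = 2 * (q * ∑ d ∈ D, (M - d)) := by ring
      _ ≤ 2 * ∑ e ∈ Finset.Ico 1 M, (M - e) := by omega
      _ ≤ _ := h3
  exact_mod_cast h4

open Classical in
/-- If `2jθ` is close, but not too close, to an integer, then few `d < M` have `2dθ` close to an
integer. -/
lemma card_close_le {θ κ τ : ℝ} {M j K : ℕ} {p₀ : ℤ} (hj : 0 < j) (hτ : 0 < τ)
    (hκ : 0 ≤ κ) (hκM : M * κ ≤ K) (h1 : |2 * j * θ - p₀| ≤ 2 * κ) (h2 : τ < |2 * j * θ - p₀|) :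
    ((((Finset.Ico 1 M).filter (fun d : ℕ => ∃ p : ℤ, |2 * d * θ - p| ≤ κ)).card : ℕ) : ℝ) ≤
      j * (4 * K + 5) * (2 * κ / τ + 1) := by
  set σ : ℝ := 2 * j * θ - p₀ with hσ
  set D := (Finset.Ico 1 M).filter (fun d : ℕ => ∃ p : ℤ, |2 * d * θ - p| ≤ κ) with hD
  -- With d = tj + r, 2dθ is congruent mod 1 to 2rθ + tσ: along a class mod j the phase drifts by
  -- the small step σ.
  let y : ℕ → ℝ := fun d => 2 * d * θ - (d / j : ℕ) * p₀
  have hy : ∀ d, y d = 2 * (d % j : ℕ) * θ + (d / j : ℕ) * σ := by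
    intro d
    have e : (d : ℝ) = (d % j : ℕ) + j * (d / j : ℕ) := by exact_mod_cast (Nat.mod_add_div d j).symm
    simp only [y, hσ]
    nth_rw 1 [e]
    ring
  have hround : ∀ d ∈ D, |y d - round (y d)| ≤ κ := by
    intro d hd
    obtain ⟨p, hp⟩ := (Finset.mem_filter.1 hd).2
    refine (round_le (y d) (p - ((d / j : ℕ) : ℤ) * p₀)).trans (le_of_eq_of_le ?_ hp)
    simp only [y, Int.cast_sub, Int.cast_mul, Int.cast_natCast]
    ring_nf
  -- Records r and the integer approached. The drift is at most 2κM ≤ 2K in size, so at most 4K + 5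
  -- integers occur for each r.
  let φ : ℕ → ℕ × ℤ := fun d => (d % j, round (y d) - ⌊2 * (d % j : ℕ) * θ⌋)
  let t : Finset (ℕ × ℤ) := Finset.range j ×ˢ Finset.Icc (-2 * K - 2 : ℤ) (2 * K + 2)
  have hmaps : ∀ d ∈ D, φ d ∈ t := by
    intro d hd
    have hdM := Finset.mem_Ico.1 (Finset.mem_filter.1 hd).1
    simp only [φ, t, Finset.mem_product, Finset.mem_range, Finset.mem_Icc]
    refine ⟨Nat.mod_lt _ hj, ?_⟩
    have hb : |((d / j : ℕ) : ℝ) * σ| ≤ 2 * K := by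
      rw [abs_mul, Nat.abs_cast]
      have : ((d / j : ℕ) : ℝ) ≤ M := by
        have := Nat.div_le_self d j
        exact_mod_cast (by omega : d / j ≤ M)
      calc _ ≤ (M : ℝ) * (2 * κ) := by gcongr
        _ ≤ _ := by linarith
    have hr := abs_sub_round (y d)
    rw [hy d] at hr ⊢
    have f1 := Int.floor_le (2 * (d % j : ℕ) * θ)
    have f2 := Int.lt_floor_add_one (2 * (d % j : ℕ) * θ)
    rw [abs_le] at hb hr
    constructor
    · have : ((-2 * K - 2 : ℤ) : ℝ) ≤ ((round (2 * (d % j : ℕ) * θ + (d / j : ℕ) * σ) -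
          ⌊2 * (d % j : ℕ) * θ⌋ : ℤ) : ℝ) := by
        push_cast; linarith
      exact_mod_cast this
    · have : ((round (2 * (d % j : ℕ) * θ + (d / j : ℕ) * σ) -
          ⌊2 * (d % j : ℕ) * θ⌋ : ℤ) : ℝ) ≤ ((2 * K + 2 : ℤ) : ℝ) := by
        push_cast; linarith
      exact_mod_cast this
  -- On a fibre tσ stays in an interval of length 2κ while the steps exceed τ in size.
  have hfib : ∀ b ∈ t, (D.filter (fun d => φ d = b)).card ≤ ⌊2 * κ / τ⌋₊ + 1 := by
    intro b _
    rcases (D.filter (fun d => φ d = b)).eq_empty_or_nonempty with h | h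
    · rw [h]; simp
    set d₀ := (D.filter (fun d => φ d = b)).min' h
    have hd₀ := Finset.min'_mem _ h
    have hd₀' := Finset.mem_filter.1 hd₀
    have hsub : ∀ d ∈ D.filter (fun d => φ d = b),
        d / j ∈ Finset.Icc (d₀ / j) (d₀ / j + ⌊2 * κ / τ⌋₊) := by
      intro d hd
      have hd' := Finset.mem_filter.1 hd
      have hle : d₀ ≤ d := Finset.min'_le _ _ hd
      have hdiv : d₀ / j ≤ d / j := Nat.div_le_div_right hle
      rw [Finset.mem_Icc]
      refine ⟨hdiv, ?_⟩
      have e : φ d = φ d₀ := hd'.2.trans hd₀'.2.symm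
      simp only [φ, Prod.mk.injEq] at e
      have emod := e.1
      rw [e.1] at e
      have er : round (y d) = round (y d₀) := by have := e.2; omega
      have a1 := hround d hd'.1
      have a2 := hround d₀ hd₀'.1
      rw [er] at a1
      have a3 : |((d / j : ℕ) - (d₀ / j : ℕ) : ℝ) * σ| ≤ 2 * κ := by
        have : ((d / j : ℕ) - (d₀ / j : ℕ) : ℝ) * σ = (y d - round (y d₀)) - (y d₀ - round (y d₀)) := by
          rw [hy d, hy d₀, emod]; ring
        rw [this]
        exact (abs_sub _ _).trans (by linarith)
      have hc : (d₀ / j : ℕ) ≤ ((d / j : ℕ) : ℝ) := by exact_mod_cast hdiv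
      rw [abs_mul, abs_of_nonneg (by linarith)] at a3
      have a4 : ((d / j - d₀ / j : ℕ) : ℝ) ≤ 2 * κ / τ := by
        rw [Nat.cast_sub hdiv, le_div_iff₀ hτ]
        nlinarith
      have := Nat.le_floor a4
      omega
    calc _ ≤ (Finset.Icc (d₀ / j) (d₀ / j + ⌊2 * κ / τ⌋₊)).card := by
          refine Finset.card_le_card_of_injOn (fun d => d / j) hsub ?_
          intro d hd d' hd' e
          have h1 := (Finset.mem_filter.1 hd).2
          have h2 := (Finset.mem_filter.1 hd').2
          have h3 := congrArg Prod.fst (h1.trans h2.symm)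
          simp only [φ] at h3 e
          rw [← Nat.mod_add_div d j, ← Nat.mod_add_div d' j, h3, e]
      _ = _ := by simp; omega
  have hcard := Finset.card_le_mul_card_image_of_maps_to hmaps _ hfib
  have ht : t.card = j * (4 * K + 5) := by
    simp only [t, Finset.card_product, Finset.card_range, Int.card_Icc]
    congr 1; omega
  rw [ht] at hcard
  calc (D.card : ℝ) ≤ ((⌊2 * κ / τ⌋₊ + 1) * (j * (4 * K + 5)) : ℕ) := by exact_mod_cast hcard
    _ = j * (4 * K + 5) * ((⌊2 * κ / τ⌋₊ : ℝ) + 1) := by push_cast; ring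
    _ ≤ _ := by
      gcongr
      exact Nat.floor_le (by positivity)

/-- Quadratic exponential sums at frequencies which are far from the fractions with denominator
`2j`, `j < q`. -/
lemma quadratic_sum_bound (q : ℕ) (hq : 0 < q) {δ : ℝ} (hδ : 0 < δ) :
    ∃ C : ℝ, 0 < C ∧ ∃ M₀ : ℕ, ∀ M : ℕ, M₀ ≤ M → ∀ (n₀ : ℕ) (θ : ℝ),
      (∀ j ∈ Finset.Ico 1 q, ∀ p : ℤ, C / (M : ℝ) ^ 2 < |2 * j * θ - p|) →
      ‖∑ n ∈ Finset.range M, expChar (((n₀ + n : ℕ) : ℝ) ^ 2 * θ)‖ ^ 2 ≤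
        (1 / q + δ) * (M : ℝ) ^ 2 := by
  classical
  obtain ⟨K, hK⟩ := exists_nat_gt (4 / δ)
  have hK0 : (0 : ℝ) < K := lt_trans (by positivity) hK
  have hKδ : 4 ≤ K * δ := by
    rw [div_lt_iff₀ hδ] at hK; exact hK.le
  obtain ⟨M₀, hM₀⟩ := exists_nat_gt (8 * q * (4 * K + 5) / δ + 4 / δ + 1)
  have hq' : (0 : ℝ) < q := by exact_mod_cast hq
  -- Chosen so that with κ = K/M and τ = C/M² the ratio 2κ/τ is δM/(8q(4K + 5)): the count in
  -- `card_close_le` is then a small multiple of M.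
  refine ⟨16 * q * K * (4 * K + 5) / δ, by positivity, M₀, ?_⟩
  intro M hM n₀ θ hθ
  have hMM : (M₀ : ℝ) ≤ M := by exact_mod_cast hM
  have hMbig : 8 * q * (4 * K + 5) / δ + 4 / δ + 1 < M := lt_of_lt_of_le hM₀ hMM
  have p1 : 0 < 8 * q * (4 * K + 5) / δ := by positivity
  have p2 : 0 < 4 / δ := by positivity
  have hM1 : 8 * q * (4 * K + 5) ≤ δ * M := by
    have : 8 * q * (4 * K + 5) / δ ≤ M := by linarith
    rw [div_le_iff₀ hδ] at this; linarith
  have hM2 : 4 ≤ δ * M := by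
    have : 4 / δ ≤ M := by linarith
    rw [div_le_iff₀ hδ] at this; linarith
  have hMpos : (0 : ℝ) < M := by linarith
  have hκ : (0 : ℝ) < K / M := by positivity
  refine (weyl_differencing hκ n₀ M).trans ?_
  set D := (Finset.Ico 1 M).filter (fun d : ℕ => ∃ p : ℤ, |2 * d * θ - p| ≤ (K : ℝ) / M) with hD
  have b1 : (M : ℝ) ≤ δ / 4 * M ^ 2 := by nlinarith
  have b2 : (M : ℝ) / (K / M) ≤ δ / 4 * M ^ 2 := by
    have : (M : ℝ) / (K / M) = M ^ 2 / K := by field_simp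
    rw [this, div_le_iff₀ hK0]
    nlinarith [sq_nonneg (M : ℝ)]
  -- If some 2jθ with j < q is within 2κ of an integer, the close shifts are few. Otherwise they are
  -- q-separated, since the difference of two close shifts has phase within 2κ of an integer, and
  -- they contribute at most M²/q.
  by_cases hex : ∃ j ∈ Finset.Ico 1 q, ∃ p : ℤ, |2 * j * θ - p| ≤ 2 * ((K : ℝ) / M)
  · obtain ⟨j, hj, p, hp⟩ := hex
    have hj' := Finset.mem_Ico.1 hj
    have hc := card_close_le (K := K) (M := M) (by omega) (by positivity) hκ.le
      (by field_simp; exact le_rfl) hp (hθ j hj p)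
    rw [← hD] at hc
    have hc2 : (D.card : ℝ) ≤ δ / 4 * M := by
      have e : 2 * ((K : ℝ) / M) / (16 * q * K * (4 * K + 5) / δ / M ^ 2) =
          δ * M / (8 * q * (4 * K + 5)) := by
        field_simp; ring
      rw [e] at hc
      have hjq : (j : ℝ) ≤ q := by exact_mod_cast hj'.2.le
      calc (D.card : ℝ) ≤ _ := hc
        _ ≤ q * (4 * K + 5) * (δ * M / (8 * q * (4 * K + 5)) + 1) := by gcongr
        _ = δ * M / 8 + q * (4 * K + 5) := by field_simp
        _ ≤ _ := by linarith
    have hs : ∑ d ∈ D, ((M - d : ℕ) : ℝ) ≤ D.card * M := by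
      refine (Finset.sum_le_card_nsmul _ _ (M : ℝ) ?_).trans (by rw [nsmul_eq_mul])
      intro d _
      exact_mod_cast Nat.sub_le M d
    have : (D.card : ℝ) * M ≤ δ / 4 * M * M := by gcongr
    have : 0 < 1 / (q : ℝ) * M ^ 2 := by positivity
    nlinarith
  · push Not at hex
    have hs := sum_sub_le_of_separated (q := q) (M := M) (D := D) (Finset.filter_subset _ _) ?_ ?_
    · have : 2 * ∑ d ∈ D, ((M - d : ℕ) : ℝ) ≤ 1 / q * M ^ 2 := by
        rw [div_mul_eq_mul_div, one_mul, le_div_iff₀ hq']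
        linarith
      nlinarith
    · intro d hd
      by_contra hlt
      obtain ⟨h1, p, hp⟩ := Finset.mem_filter.1 hd
      have := hex d (Finset.mem_Ico.2 ⟨(Finset.mem_Ico.1 h1).1, by omega⟩) p
      linarith
    · intro d hd d' hd' hlt
      by_contra hcon
      obtain ⟨h1, p, hp⟩ := Finset.mem_filter.1 hd
      obtain ⟨h1', p', hp'⟩ := Finset.mem_filter.1 hd'
      have := hex (d' - d) (Finset.mem_Ico.2 ⟨by omega, by omega⟩) (p' - p)
      rw [Nat.cast_sub hlt.le] at this
      push_cast at this
      have e : 2 * ((d' : ℝ) - d) * θ - (p' - p) = (2 * d' * θ - p') - (2 * d * θ - p) := by ring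
      rw [e] at this
      have := abs_sub (2 * (d' : ℝ) * θ - p') (2 * d * θ - p)
      linarith

/-! ### Orthogonality, Parseval and bilinear sums. -/

lemma sum_expChar_eq_zero {P : ℕ} {m : ℤ} (hm : m ≠ 0) (hmP : |m| < P) :
    ∑ ξ ∈ Finset.range P, expChar (m * (ξ / P)) = 0 := by
  have hP : (0 : ℝ) < P := by
    have := abs_nonneg m
    exact_mod_cast lt_of_le_of_lt this hmP
  have h0 : expChar (m / P) ≠ 1 := by
    intro h
    rw [expChar, Complex.exp_eq_one_iff] at h
    obtain ⟨n, hn⟩ := h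
    have hpi : (2 * (Real.pi : ℂ) * Complex.I) ≠ 0 := Complex.two_pi_I_ne_zero
    have h1 : ((m / P : ℝ) : ℂ) = ((n : ℝ) : ℂ) := by
      have : (2 * (Real.pi : ℂ) * Complex.I) * ((m / P : ℝ) : ℂ) =
          (2 * (Real.pi : ℂ) * Complex.I) * ((n : ℝ) : ℂ) := by
        push_cast at hn ⊢
        linear_combination hn
      exact mul_left_cancel₀ hpi this
    have h2 : (m : ℝ) / P = n := by exact_mod_cast h1
    rw [div_eq_iff hP.ne'] at h2
    have h3 : m = n * P := by exact_mod_cast h2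
    have h4 : (P : ℤ) ∣ m := ⟨n, by rw [h3]; ring⟩
    exact hm (Int.eq_zero_of_abs_lt_dvd h4 hmP)
  have e : ∀ ξ ∈ Finset.range P, expChar (m * (ξ / P)) = expChar (m / P) ^ ξ := by
    intro ξ _
    rw [← expChar_nat_mul]; congr 1; ring
  rw [Finset.sum_congr rfl e, geom_sum_eq h0, ← expChar_nat_mul]
  have : (P : ℝ) * (m / P) = m := by field_simp
  rw [this, expChar_int]; simp

lemma sum_expChar_eq_ite {P : ℕ} {m : ℤ} (hmP : |m| < P) :
    ∑ ξ ∈ Finset.range P, expChar (m * (ξ / P)) = if m = 0 then (P : ℂ) else 0 := by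
  split_ifs with h
  · subst h; simp [expChar_zero]
  · exact sum_expChar_eq_zero h hmP

lemma parseval_expChar {P : ℕ} {X : Finset ℕ} (hX : X ⊆ Finset.range P) (f : ℕ → ℝ) :
    ∑ ξ ∈ Finset.range P, ‖∑ a ∈ X, (f a : ℂ) * expChar (-(a * (ξ / P)))‖ ^ 2 =
      P * ∑ a ∈ X, f a ^ 2 := by
  have h : ∀ ξ : ℕ, ((‖∑ a ∈ X, (f a : ℂ) * expChar (-(a * (ξ / P)))‖ ^ 2 : ℝ) : ℂ) =
      ∑ a ∈ X, ∑ b ∈ X, (f a : ℂ) * f b * expChar (((b - a : ℤ) : ℝ) * (ξ / P)) := by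
    intro ξ
    push_cast
    rw [← Complex.mul_conj', map_sum, Finset.sum_mul_sum]
    refine Finset.sum_congr rfl fun a _ => Finset.sum_congr rfl fun b _ => ?_
    rw [map_mul, Complex.conj_ofReal, conj_expChar]
    have : expChar (((b : ℝ) - a) * (ξ / P)) =
        expChar (-(a * (ξ / P))) * expChar (- -(b * (ξ / P))) := by
      rw [← expChar_add]; congr 1; ring
    rw [this]; ring
  have : ((∑ ξ ∈ Finset.range P, ‖∑ a ∈ X, (f a : ℂ) * expChar (-(a * (ξ / P)))‖ ^ 2 : ℝ) : ℂ) =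
      ((P * ∑ a ∈ X, f a ^ 2 : ℝ) : ℂ) := by
    rw [Complex.ofReal_sum, Finset.sum_congr rfl fun ξ _ => h ξ, Finset.sum_comm]
    have : ∀ a ∈ X, ∑ ξ ∈ Finset.range P, ∑ b ∈ X,
        (f a : ℂ) * f b * expChar (((b - a : ℤ) : ℝ) * (ξ / P)) = P * (f a : ℂ) ^ 2 := by
      intro a ha
      rw [Finset.sum_comm, Finset.sum_eq_single_of_mem a ha]
      · rw [← Finset.mul_sum, sum_expChar_eq_ite]
        · simp; ring
        · have := Finset.mem_range.1 (hX ha); simp; omega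
      · intro b hb hab
        rw [← Finset.mul_sum, sum_expChar_eq_zero, mul_zero]
        · intro h; apply hab; omega
        · have := Finset.mem_range.1 (hX ha); have := Finset.mem_range.1 (hX hb)
          rw [abs_lt]; constructor <;> omega
    rw [Finset.sum_congr rfl this, ← Finset.mul_sum]
    push_cast; rfl
  exact_mod_cast this

/-- A bilinear sum over pairs `(a, b)` weighted by a function of `a + b` is controlled by the
supremum of the exponential sum of that function. -/
lemma bilinear_sum_le (X Y W : Finset ℕ) (f g k : ℕ → ℝ) {Λ : ℝ}
    (hΛ : ∀ θ : ℝ, ‖∑ s ∈ W, (k s : ℂ) * expChar (s * θ)‖ ≤ Λ) :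
    |∑ a ∈ X, ∑ b ∈ Y, if a + b ∈ W then f a * g b * k (a + b) else 0| ≤
      Λ / 2 * (∑ a ∈ X, f a ^ 2 + ∑ b ∈ Y, g b ^ 2) := by
  obtain ⟨Q, hQ⟩ := Finset.exists_nat_subset_range (X ∪ Y ∪ W)
  have hX : ∀ a ∈ X, a < Q := fun a ha => Finset.mem_range.1 (hQ (by simp [ha]))
  have hY : ∀ a ∈ Y, a < Q := fun a ha => Finset.mem_range.1 (hQ (by simp [ha]))
  have hW : ∀ a ∈ W, a < Q := fun a ha => Finset.mem_range.1 (hQ (by simp [ha]))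
  -- Large enough that s − a − b vanishes mod P only when a + b = s.
  set P := 2 * Q + 1 with hP
  have hP0 : (0 : ℝ) < P := by rw [hP]; positivity
  set F : ℕ → ℂ := fun ξ => ∑ a ∈ X, (f a : ℂ) * expChar (-(a * (ξ / P))) with hF
  set G : ℕ → ℂ := fun ξ => ∑ b ∈ Y, (g b : ℂ) * expChar (-(b * (ξ / P))) with hG
  set H : ℕ → ℂ := fun ξ => ∑ s ∈ W, (k s : ℂ) * expChar (s * (ξ / P)) with hH
  have hpF := parseval_expChar (P := P) (X := X)
    (fun a ha => Finset.mem_range.2 (by have := hX a ha; omega)) f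
  have hpG := parseval_expChar (P := P) (X := Y)
    (fun a ha => Finset.mem_range.2 (by have := hY a ha; omega)) g
  have key : ((P * ∑ a ∈ X, ∑ b ∈ Y, if a + b ∈ W then f a * g b * k (a + b) else 0 : ℝ) : ℂ) =
      ∑ ξ ∈ Finset.range P, H ξ * (F ξ * G ξ) := by
    have e1 : ∀ ξ, H ξ * (F ξ * G ξ) = ∑ a ∈ X, ∑ b ∈ Y, ∑ s ∈ W,
        (f a : ℂ) * g b * k s * expChar (((s - a - b : ℤ) : ℝ) * (ξ / P)) := by
      intro ξ
      simp only [hF, hG, hH]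
      simp_rw [Finset.sum_mul_sum, Finset.mul_sum]
      refine Finset.sum_comm.trans (Finset.sum_congr rfl fun a _ =>
        Finset.sum_comm.trans (Finset.sum_congr rfl fun b _ =>
          Finset.sum_congr rfl fun s _ => ?_))
      have : expChar (((s - a - b : ℤ) : ℝ) * (ξ / P)) =
          expChar (s * (ξ / P)) * (expChar (-(a * (ξ / P))) * expChar (-(b * (ξ / P)))) := by
        rw [← expChar_add, ← expChar_add]; congr 1; push_cast; ring
      rw [this]; ring
    rw [Finset.sum_congr rfl fun ξ _ => e1 ξ, Complex.ofReal_mul, Complex.ofReal_sum,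
      Finset.mul_sum]
    refine Eq.trans (Finset.sum_congr rfl fun a ha => ?_) Finset.sum_comm
    rw [Complex.ofReal_sum, Finset.mul_sum]
    refine Eq.trans (Finset.sum_congr rfl fun b hb => ?_) Finset.sum_comm
    refine Eq.trans ?_ Finset.sum_comm
    have e2 : ∀ s ∈ W, ∑ ξ ∈ Finset.range P,
        (f a : ℂ) * g b * k s * expChar (((s - a - b : ℤ) : ℝ) * (ξ / P)) =
        if a + b = s then (P : ℂ) * (f a * g b * k s) else 0 := by
      intro s hs
      have h1 := hX a ha
      have h2 := hY b hb
      have h3 := hW s hs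
      rw [← Finset.mul_sum, sum_expChar_eq_ite (by rw [abs_lt]; constructor <;> omega)]
      by_cases h : a + b = s
      · rw [if_pos (by omega), if_pos h]; ring
      · rw [if_neg (by omega), if_neg h, mul_zero]
    rw [Finset.sum_congr rfl e2, Finset.sum_ite_eq]
    split_ifs <;> push_cast <;> simp
  have hbound : P * |∑ a ∈ X, ∑ b ∈ Y, if a + b ∈ W then f a * g b * k (a + b) else 0| ≤
      ∑ ξ ∈ Finset.range P, Λ / 2 * (‖F ξ‖ ^ 2 + ‖G ξ‖ ^ 2) := by
    have hc := congrArg norm key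
    rw [Complex.norm_real, Real.norm_eq_abs, abs_mul, abs_of_pos hP0] at hc
    rw [hc]
    refine (norm_sum_le _ _).trans (Finset.sum_le_sum fun ξ _ => ?_)
    rw [norm_mul, norm_mul]
    have h1 : ‖H ξ‖ ≤ Λ := hΛ (ξ / P)
    have h0 : 0 ≤ Λ := (norm_nonneg _).trans h1
    calc _ ≤ Λ * (‖F ξ‖ * ‖G ξ‖) := by gcongr
      _ ≤ _ := by nlinarith [sq_nonneg (‖F ξ‖ - ‖G ξ‖)]
  rw [← Finset.mul_sum, Finset.sum_add_distrib, hpF, hpG] at hbound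
  have : P * |∑ a ∈ X, ∑ b ∈ Y, if a + b ∈ W then f a * g b * k (a + b) else 0| ≤
      P * (Λ / 2 * (∑ a ∈ X, f a ^ 2 + ∑ b ∈ Y, g b ^ 2)) := by
    linarith
  exact le_of_mul_le_mul_left this hP0

/-! ### Weighted squares and their periodic model. -/

/-- Summation by parts: bounded partial sums against a Lipschitz weight. -/
lemma norm_sum_mul_le_of_partial {𝕜 : Type*} [NormedField 𝕜] (u v : ℕ → 𝕜) {B η : ℝ} (Y : ℕ)
    (hu : ∀ y ≤ Y, ‖∑ n ∈ Finset.range y, u n‖ ≤ B)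
    (hv : ∀ n, ‖v (n + 1) - v n‖ ≤ η) :
    ‖∑ n ∈ Finset.range Y, u n * v n‖ ≤ B * (‖v Y‖ + η * Y) := by
  have hB : 0 ≤ B := (norm_nonneg _).trans (hu 0 (Nat.zero_le _))
  have key : ∀ y ≤ Y, ‖∑ n ∈ Finset.range y, u n * v n - (∑ n ∈ Finset.range y, u n) * v y‖
      ≤ B * (η * y) := by
    intro y
    induction y with
    | zero => simp
    | succ y ih =>
      intro hy
      have e : ∑ n ∈ Finset.range (y + 1), u n * v n - (∑ n ∈ Finset.range (y + 1), u n) * v (y + 1)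
          = (∑ n ∈ Finset.range y, u n * v n - (∑ n ∈ Finset.range y, u n) * v y)
            - (∑ n ∈ Finset.range (y + 1), u n) * (v (y + 1) - v y) := by
        rw [Finset.sum_range_succ, Finset.sum_range_succ]; ring
      rw [e]
      refine (norm_sub_le _ _).trans ?_
      rw [norm_mul]
      have h1 := ih (by omega)
      have h2 : ‖∑ n ∈ Finset.range (y + 1), u n‖ * ‖v (y + 1) - v y‖ ≤ B * η :=
        mul_le_mul (hu _ hy) (hv y) (norm_nonneg _) hB
      push_cast
      linarith
  have h1 := key Y le_rfl
  have h2 : ‖(∑ n ∈ Finset.range Y, u n) * v Y‖ ≤ B * ‖v Y‖ := by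
    rw [norm_mul]; gcongr; exact hu Y le_rfl
  have h3 := norm_add_le (∑ n ∈ Finset.range Y, u n * v n - (∑ n ∈ Finset.range Y, u n) * v Y)
    ((∑ n ∈ Finset.range Y, u n) * v Y)
  rw [sub_add_cancel] at h3
  linarith

/-- Partial sums of a periodic function whose sum over a period vanishes. -/
lemma abs_sum_range_le_of_periodic {h : ℕ → ℝ} {m : ℕ} {B : ℝ} (hm : 0 < m)
    (hper : ∀ n, h (m + n) = h n) (hzero : ∑ n ∈ Finset.range m, h n = 0) (hB : ∀ n, |h n| ≤ B)
    (y : ℕ) : |∑ n ∈ Finset.range y, h n| ≤ m * B := by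
  have hB0 : 0 ≤ B := (abs_nonneg _).trans (hB 0)
  induction y using Nat.strong_induction_on with
  | _ y ih =>
    rcases lt_or_ge y m with hy | hy
    · refine (Finset.abs_sum_le_sum_abs _ _).trans ?_
      refine (Finset.sum_le_card_nsmul _ _ B fun n _ => hB n).trans ?_
      rw [Finset.card_range, nsmul_eq_mul]
      gcongr
    · obtain ⟨z, rfl⟩ := Nat.exists_eq_add_of_le hy
      rw [Finset.sum_range_add, hzero, zero_add, Finset.sum_congr rfl fun n _ => hper n]
      exact ih z (by omega)

/-- The weight of a square, normalised to have mean one in the integers: multiples of `3` have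
twice the weight of the other squares. -/
noncomputable def sqWeight (n : ℕ) : ℝ := if 3 ∣ n then 3 / 2 else 3 / 4

/-- The weighted indicator function of the squares, with mean value one. -/
noncomputable def sqKernel (s : ℕ) : ℝ :=
  if IsSquare s then 2 * (s.sqrt : ℝ) * sqWeight s.sqrt else 0

/-- The periodic function which models `sqKernel`. -/
noncomputable def sqModel (s : ℕ) : ℝ := if s % 12 ∈ ({0, 1, 4, 9} : Finset ℕ) then 3 else 0

lemma sqWeight_nonneg (n : ℕ) : 0 ≤ sqWeight n := by
  unfold sqWeight; split_ifs <;> norm_num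

lemma sqWeight_le (n : ℕ) : sqWeight n ≤ 3 / 2 := by
  unfold sqWeight; split_ifs <;> norm_num

lemma sqWeight_add_six (n : ℕ) : sqWeight (6 + n) = sqWeight n := by
  unfold sqWeight
  have : 3 ∣ 6 + n ↔ 3 ∣ n := by omega
  simp [this]

/-- A sum over squares, as a sum over their roots. -/
lemma sum_isSquare_eq {𝕜 : Type*} [AddCommMonoid 𝕜] (F : ℕ → ℕ → 𝕜) {x y : ℕ}
    (h : ∀ n, n ^ 2 < x ↔ n < y) :
    ∑ s ∈ Finset.range x, (if IsSquare s then F s s.sqrt else 0) =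
      ∑ n ∈ Finset.range y, F (n ^ 2) n := by
  rw [← Finset.sum_filter]
  symm
  refine Finset.sum_nbij' (fun n => n ^ 2) (fun s => s.sqrt) ?_ ?_ ?_ ?_ ?_
  · intro n hn
    simp only [Finset.mem_filter, Finset.mem_range] at *
    exact ⟨(h n).2 hn, ⟨n, sq n⟩⟩
  · intro s hs
    simp only [Finset.mem_filter, Finset.mem_range] at *
    obtain ⟨hs, n, rfl⟩ := hs
    rw [Nat.sqrt_eq]
    exact (h n).1 (by rwa [sq])
  · intro n _; exact Nat.sqrt_eq' n
  · intro s hs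
    simp only [Finset.mem_filter] at hs
    obtain ⟨_, n, rfl⟩ := hs
    rw [Nat.sqrt_eq, sq]
  · intro n _; rw [Nat.sqrt_eq']

lemma exists_sq_lt_iff (x : ℕ) : ∃ y : ℕ, (∀ n, n ^ 2 < x ↔ n < y) ∧ y ≤ x.sqrt + 1 ∧
    x ≤ y ^ 2 ∧ y ^ 2 ≤ x + 2 * y := by
  rcases Nat.eq_zero_or_pos x with rfl | hx
  · exact ⟨0, by simp⟩
  · have h : ∀ n, n ^ 2 < x ↔ n < (x - 1).sqrt + 1 := by
      intro n
      rw [Nat.lt_succ_iff, Nat.le_sqrt']; omega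
    refine ⟨(x - 1).sqrt + 1, h, ?_, ?_, ?_⟩
    · have := Nat.sqrt_le_sqrt (Nat.sub_le x 1); omega
    · by_contra hc
      have := (h ((x - 1).sqrt + 1)).1 (by omega)
      omega
    · have := (h (x - 1).sqrt).2 (by omega)
      nlinarith

lemma sq_mod_twelve_add_six (n : ℕ) : (6 + n) ^ 2 % 12 = n ^ 2 % 12 := by
  have : (6 + n) ^ 2 = n ^ 2 + 12 * (n + 3) := by ring
  rw [this, Nat.add_mul_mod_self_left]

/-- The squares and their periodic model have nearly the same partial sums in residue classes. -/
lemma abs_sum_class_sub_le (r x : ℕ) :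
    |∑ s ∈ Finset.range x, if s % 12 = r then sqKernel s - sqModel s else 0| ≤
      100 * ((x.sqrt : ℝ) + 1) := by
  obtain ⟨y, hy, hy1, hxy, hyx⟩ := exists_sq_lt_iff x
  -- Common mean, on the class r mod 12, of the weight over roots (period 6) and of the model (3/12
  -- on an allowed class).
  set ρ : ℝ := if r ∈ ({0, 1, 4, 9} : Finset ℕ) then 1 / 4 else 0 with hρ
  have hρ0 : 0 ≤ ρ ∧ ρ ≤ 1 / 4 := by rw [hρ]; split_ifs <;> norm_num
  set h : ℕ → ℝ := fun n => (if n ^ 2 % 12 = r then sqWeight n else 0) - ρ with hh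
  set g : ℕ → ℝ := fun s => (if s % 12 = r then sqModel s else 0) - ρ with hg
  have e1 : ∑ s ∈ Finset.range x, (if s % 12 = r then sqKernel s else 0) =
      ∑ n ∈ Finset.range y, h n * (2 * n) + ρ * ∑ n ∈ Finset.range y, (2 * (n : ℝ)) := by
    have := sum_isSquare_eq (fun s n => if s % 12 = r then 2 * (n : ℝ) * sqWeight n else 0) hy
    rw [Finset.mul_sum, ← Finset.sum_add_distrib]
    convert this using 1
    · refine Finset.sum_congr rfl fun s _ => ?_
      unfold sqKernel
      split_ifs <;> simp_all
    · refine Finset.sum_congr rfl fun n _ => ?_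
      simp only [hh]
      split_ifs <;> ring
  have e2 : ∑ s ∈ Finset.range x, (if s % 12 = r then sqModel s else 0) =
      ∑ s ∈ Finset.range x, g s + ρ * x := by
    simp only [hg, Finset.sum_sub_distrib]
    simp; ring
  have e3 : ∑ n ∈ Finset.range y, (2 * (n : ℝ)) = (y : ℝ) ^ 2 - y := by
    clear hy hy1 hxy hyx e1
    induction y with
    | zero => simp
    | succ y ih => rw [Finset.sum_range_succ, ih]; push_cast; ring
  have hh12 : ∀ z, |∑ n ∈ Finset.range z, h n| ≤ (6 : ℕ) * 2 := by
    refine abs_sum_range_le_of_periodic (by norm_num) ?_ ?_ ?_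
    · intro n; simp only [hh, sq_mod_twelve_add_six, sqWeight_add_six]
    · simp only [hh, hρ, sqWeight, Finset.sum_range_succ, Finset.sum_range_zero]
      by_cases hr : r < 12
      · interval_cases r <;> norm_num
      · have h1 : r ∉ ({0, 1, 4, 9} : Finset ℕ) := by simp; omega
        rw [if_neg h1]
        norm_num
        have : ¬ 0 = r ∧ ¬ 1 = r ∧ ¬ 4 = r ∧ ¬ 9 = r := by omega
        simp [this]
    · intro n
      have h1 := sqWeight_nonneg n
      have h2 := sqWeight_le n
      simp only [hh]
      rw [abs_le]
      split_ifs <;> constructor <;> linarith [hρ0.1, hρ0.2]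
  have hg48 : |∑ n ∈ Finset.range x, g n| ≤ (12 : ℕ) * 4 := by
    refine abs_sum_range_le_of_periodic (by norm_num) ?_ ?_ ?_ x
    · intro n; simp only [hg, sqModel, Nat.add_mod_left]
    · simp only [hg, hρ, sqModel, Finset.sum_range_succ, Finset.sum_range_zero]
      by_cases hr : r < 12
      · interval_cases r <;> norm_num
      · have h1 : r ∉ ({0, 1, 4, 9} : Finset ℕ) := by simp; omega
        rw [if_neg h1]
        norm_num
        have : ¬ 0 = r ∧ ¬ 1 = r ∧ ¬ 4 = r ∧ ¬ 9 = r := by omega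
        simp [this]
    · intro n
      have h1 : 0 ≤ sqModel n := by unfold sqModel; split_ifs <;> norm_num
      have h2 : sqModel n ≤ 3 := by unfold sqModel; split_ifs <;> norm_num
      simp only [hg]
      rw [abs_le]
      split_ifs <;> constructor <;> linarith [hρ0.1, hρ0.2]
  have habel := norm_sum_mul_le_of_partial h (fun n => 2 * (n : ℝ)) (B := (6 : ℕ) * 2) (η := 2) y
    (fun z _ => by rw [Real.norm_eq_abs]; exact hh12 z)
    (fun n => by rw [Real.norm_eq_abs]; push_cast; ring_nf; norm_num)
  rw [Real.norm_eq_abs, Real.norm_eq_abs, abs_of_nonneg (by positivity : 0 ≤ 2 * (y : ℝ))] at habel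
  have e4 : ∑ s ∈ Finset.range x, (if s % 12 = r then sqKernel s - sqModel s else 0) =
      ∑ n ∈ Finset.range y, h n * (2 * n) - ∑ s ∈ Finset.range x, g s
        + ρ * ((y : ℝ) ^ 2 - y - x) := by
    have : ∑ s ∈ Finset.range x, (if s % 12 = r then sqKernel s - sqModel s else 0) =
        ∑ s ∈ Finset.range x, (if s % 12 = r then sqKernel s else 0) -
        ∑ s ∈ Finset.range x, (if s % 12 = r then sqModel s else 0) := by
      rw [← Finset.sum_sub_distrib]
      refine Finset.sum_congr rfl fun s _ => ?_
      split_ifs <;> simp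
    rw [this, e1, e2, e3]; ring
  rw [e4]
  have c1 : (y : ℝ) ≤ x.sqrt + 1 := by exact_mod_cast hy1
  have c2 : (x : ℝ) ≤ (y : ℝ) ^ 2 := by exact_mod_cast hxy
  have c3 : (y : ℝ) ^ 2 ≤ x + 2 * y := by exact_mod_cast hyx
  have c0 : (0 : ℝ) ≤ y := by positivity
  have hlast : |ρ * ((y : ℝ) ^ 2 - y - x)| ≤ 1 / 4 * y := by
    rw [abs_mul, abs_of_nonneg hρ0.1]
    have : |(y : ℝ) ^ 2 - y - x| ≤ y := by rw [abs_le]; constructor <;> linarith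
    exact mul_le_mul hρ0.2 this (abs_nonneg _) (by norm_num)
  rw [abs_le] at *
  push_cast at habel hg48
  constructor <;> linarith [habel.1, habel.2, hg48.1, hg48.2, hlast.1, hlast.2]

/-! ### Exponential sums of the kernel minus the model. -/

lemma sum_range_three_mul (F : ℕ → ℂ) (t : ℕ) :
    ∑ n ∈ Finset.range (3 * t), (if 3 ∣ n then F n else 0) = ∑ k ∈ Finset.range t, F (3 * k) := by
  induction t with
  | zero => simp
  | succ t ih =>
    rw [show 3 * (t + 1) = 3 * t + 1 + 1 + 1 by ring, Finset.sum_range_succ, Finset.sum_range_succ,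
      Finset.sum_range_succ, ih, Finset.sum_range_succ, if_pos ⟨t, rfl⟩, if_neg (by omega),
      if_neg (by omega)]
    ring

/-- Partial sums of the twisted difference of the squares and their model, at frequencies
with denominator `12`. -/
lemma norm_sum_twisted_le (p : ℤ) (x : ℕ) :
    ‖∑ s ∈ Finset.range x, ((sqKernel s - sqModel s : ℝ) : ℂ) * expChar (s * (p / 12))‖ ≤
      1200 * ((x.sqrt : ℝ) + 1) := by
  have e : ∀ s : ℕ, expChar (s * (p / 12)) = expChar ((s % 12 : ℕ) * (p / 12)) := by
    intro s
    have h : (s : ℝ) = (s % 12 : ℕ) + 12 * (s / 12 : ℕ) := by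
      exact_mod_cast (Nat.mod_add_div s 12).symm
    have : (s : ℝ) * (p / 12) = (s % 12 : ℕ) * (p / 12) + ((((s / 12 : ℕ) : ℤ) * p : ℤ) : ℝ) := by
      nth_rw 1 [h]
      rw [Int.cast_mul, Int.cast_natCast]; ring
    rw [this, expChar_add_int]
  have h : ∑ s ∈ Finset.range x, ((sqKernel s - sqModel s : ℝ) : ℂ) * expChar (s * (p / 12)) =
      ∑ r ∈ Finset.range 12, expChar (r * (p / 12)) *
        ((∑ s ∈ Finset.range x, if s % 12 = r then sqKernel s - sqModel s else 0 : ℝ) : ℂ) := by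
    simp_rw [Complex.ofReal_sum, Finset.mul_sum]
    rw [Finset.sum_comm]
    refine Finset.sum_congr rfl fun s _ => ?_
    rw [Finset.sum_eq_single_of_mem (s % 12) (Finset.mem_range.2 (Nat.mod_lt _ (by norm_num)))]
    · rw [if_pos rfl, e, mul_comm]
    · intro r _ hr
      rw [if_neg (Ne.symm hr)]; simp
  rw [h]
  refine (norm_sum_le _ _).trans ((Finset.sum_le_card_nsmul _ _ (100 * ((x.sqrt : ℝ) + 1)) ?_).trans
    (by simp; linarith))
  intro r _
  rw [norm_mul, norm_expChar, one_mul, Complex.norm_real]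
  exact abs_sum_class_sub_le r x

/-- Summation by parts against e(sη), whose increments are at most 2π|η|, transfers the bound from
p/12 to nearby frequencies. -/
lemma norm_sum_near_le (p : ℤ) {η B : ℝ} {Y : ℕ} (hB : 1200 * ((Y.sqrt : ℝ) + 1) ≤ B) :
    ‖∑ s ∈ Finset.range Y, ((sqKernel s - sqModel s : ℝ) : ℂ) * expChar (s * (p / 12 + η))‖ ≤
      B * (1 + 2 * Real.pi * |η| * Y) := by
  have h := norm_sum_mul_le_of_partial
    (fun s : ℕ => ((sqKernel s - sqModel s : ℝ) : ℂ) * expChar (s * (p / 12)))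
    (fun s : ℕ => expChar (s * η)) (B := B) (η := 2 * Real.pi * |η|) Y ?_ ?_
  · rw [norm_expChar] at h
    have e : ∀ s : ℕ, ((sqKernel s - sqModel s : ℝ) : ℂ) * expChar (s * (p / 12 + η)) =
        ((sqKernel s - sqModel s : ℝ) : ℂ) * expChar (s * (p / 12)) * expChar (s * η) := by
      intro s
      rw [mul_add, expChar_add]; ring
    simp_rw [e]
    exact h
  · intro y hy
    refine (norm_sum_twisted_le p y).trans (le_trans ?_ hB)
    gcongr
  · intro n
    have : expChar (((n + 1 : ℕ) : ℝ) * η) - expChar (n * η) = expChar (n * η) * (expChar η - 1) := by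
      push_cast
      rw [add_mul, one_mul, expChar_add]; ring
    rw [this, norm_mul, norm_expChar, one_mul]
    exact norm_expChar_sub_one_le η

lemma sqModel_nonneg (s : ℕ) : 0 ≤ sqModel s := by unfold sqModel; split_ifs <;> norm_num

lemma sqModel_le (s : ℕ) : sqModel s ≤ 3 := by unfold sqModel; split_ifs <;> norm_num

lemma norm_sqModel_mul_le (s : ℕ) (θ : ℝ) : ‖(sqModel s : ℂ) * expChar (s * θ)‖ ≤ 3 := by
  rw [norm_mul, norm_expChar, mul_one, Complex.norm_real, Real.norm_eq_abs,
    abs_of_nonneg (sqModel_nonneg s)]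
  exact sqModel_le s

/-- The exponential sum of the periodic model is small away from denominator `12`. -/
lemma norm_sum_sqModel_le {θ κ : ℝ} (hκ : 0 < κ) (h : ∀ p : ℤ, κ ≤ |12 * θ - p|) (Y : ℕ) :
    ‖∑ s ∈ Finset.range Y, (sqModel s : ℂ) * expChar (s * θ)‖ ≤ 18 / κ + 36 := by
  have e : ∀ t : ℕ, ∑ s ∈ Finset.range (12 * t), (sqModel s : ℂ) * expChar (s * θ) =
      (∑ s ∈ Finset.range 12, (sqModel s : ℂ) * expChar (s * θ)) *
        ∑ i ∈ Finset.range t, expChar (i * (12 * θ)) := by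
    intro t
    induction t with
    | zero => simp
    | succ t ih =>
      rw [show 12 * (t + 1) = 12 * t + 12 by ring, Finset.sum_range_add, ih,
        Finset.sum_range_succ _ t, mul_add, Finset.sum_mul _ _ (expChar _)]
      congr 1
      refine Finset.sum_congr rfl fun s _ => ?_
      have h1 : sqModel (12 * t + s) = sqModel s := by simp [sqModel]
      have h2 : ((12 * t + s : ℕ) : ℝ) * θ = s * θ + t * (12 * θ) := by push_cast; ring
      rw [h1, h2, expChar_add]; ring
  have h36 : ∀ (z n : ℕ), n ≤ 12 →
      ‖∑ s ∈ Finset.range n, (sqModel (z + s) : ℂ) * expChar ((z + s : ℕ) * θ)‖ ≤ 36 := by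
    intro z n hn
    refine (norm_sum_le _ _).trans ((Finset.sum_le_card_nsmul _ _ 3
      fun s _ => norm_sqModel_mul_le _ _).trans ?_)
    have : (n : ℝ) ≤ 12 := by exact_mod_cast hn
    simp; linarith
  rw [← Nat.div_add_mod Y 12, Finset.sum_range_add, e]
  refine (norm_add_le _ _).trans ?_
  have h1 := norm_sum_range_expChar_le hκ h (Y / 12)
  have h2 := h36 0 12 le_rfl
  simp only [zero_add] at h2
  have h3 := h36 (12 * (Y / 12)) (Y % 12) (Nat.mod_lt _ (by norm_num)).le
  rw [norm_mul]
  have : 18 / κ = 36 * (1 / (2 * κ)) := by field_simp; norm_num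
  rw [this]
  exact add_le_add (mul_le_mul h2 h1 (norm_nonneg _) (by norm_num)) h3

/-- If `12θ` is far from the integers, then either neither `θ` nor `9θ` is close to a fraction
with denominator `2j`, `j ≤ 3`, or `θ` is not close to one with `j ≤ 8`. -/
lemma far_from_fractions {θ ψ : ℝ} (hψ : 0 < ψ) (h : ∀ p : ℤ, 200 * ψ < |12 * θ - p|) :
    (∀ j ∈ Finset.Ico 1 4, ∀ p : ℤ, ψ < |2 * (j : ℕ) * θ - p|) ∧
    ((∀ j ∈ Finset.Ico 1 4, ∀ p : ℤ, ψ < |2 * (j : ℕ) * (9 * θ) - p|) ∨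
      ∀ j ∈ Finset.Ico 1 9, ∀ p : ℤ, ψ < |2 * (j : ℕ) * θ - p|) := by
  have comb : ∀ (x y : ℝ) (p q u v : ℤ), |x - p| ≤ ψ → |y - q| ≤ 6 * ψ → u * x + v * y = 12 * θ →
      |u| + 6 * |v| ≤ 200 → False := by
    intro x y p q u v hx hy he huv
    have h1 := h (u * p + v * q)
    have e : 12 * θ - ((u * p + v * q : ℤ) : ℝ) = u * (x - p) + v * (y - q) := by
      rw [← he]; push_cast; ring
    rw [e] at h1
    have h2 := abs_add_le (u * (x - p)) (v * (y - q))
    rw [abs_mul, abs_mul] at h2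
    have h3 : |(u : ℝ)| * |x - p| ≤ |(u : ℝ)| * ψ := by gcongr
    have h4 : |(v : ℝ)| * |y - q| ≤ |(v : ℝ)| * (6 * ψ) := by gcongr
    have h5 : |(u : ℝ)| + 6 * |(v : ℝ)| ≤ 200 := by exact_mod_cast huv
    nlinarith
  have first : ∀ j ∈ Finset.Ico 1 4, ∀ p : ℤ, ψ < |2 * (j : ℕ) * θ - p| := by
    intro j hj p
    by_contra hc
    push Not at hc
    have h0 : |(0 : ℝ) - (0 : ℤ)| ≤ 6 * ψ := by simp; linarith
    rw [Finset.mem_Ico] at hj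
    obtain ⟨hj1, hj2⟩ := hj
    interval_cases j
    · exact comb _ 0 p 0 6 0 hc h0 (by push_cast; ring) (by norm_num)
    · exact comb _ 0 p 0 3 0 hc h0 (by push_cast; ring) (by norm_num)
    · exact comb _ 0 p 0 2 0 hc h0 (by push_cast; ring) (by norm_num)
  refine ⟨first, ?_⟩
  by_contra hcon
  push Not at hcon
  obtain ⟨⟨j, hj, p, hp⟩, i, hi, p', hp'⟩ := hcon
  -- Every j ≤ 3 divides 6, so 18j divides 108.
  have h108 : ∃ q : ℤ, |108 * θ - q| ≤ 6 * ψ := by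
    rw [Finset.mem_Ico] at hj
    obtain ⟨hj1, hj2⟩ := hj
    have hmul : ∀ m : ℤ, |m| ≤ 6 → m * (2 * (j : ℝ) * (9 * θ)) = 108 * θ →
        ∃ q : ℤ, |108 * θ - q| ≤ 6 * ψ := by
      intro m hm e
      refine ⟨m * p, ?_⟩
      have : 108 * θ - ((m * p : ℤ) : ℝ) = m * (2 * (j : ℝ) * (9 * θ) - p) := by
        rw [← e]; push_cast; ring
      rw [this, abs_mul]
      have hm' : |(m : ℝ)| ≤ 6 := by exact_mod_cast hm
      exact mul_le_mul hm' hp (abs_nonneg _) (by norm_num)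
    interval_cases j
    · exact hmul 6 (by norm_num) (by push_cast; ring)
    · exact hmul 3 (by norm_num) (by push_cast; ring)
    · exact hmul 2 (by norm_num) (by push_cast; ring)
  obtain ⟨q, hq⟩ := h108
  rw [Finset.mem_Ico] at hi
  obtain ⟨hi1, hi2⟩ := hi
  -- For i ≤ 8, gcd(2i, 108) divides 12, so 12θ is an integer combination of 2iθ and 108θ. This
  -- fails at i = 9, where the gcd is 18.
  interval_cases i
  · exact comb _ _ p' q 6 0 hp' hq (by push_cast; ring) (by norm_num)
  · exact comb _ _ p' q 3 0 hp' hq (by push_cast; ring) (by norm_num)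
  · exact comb _ _ p' q 2 0 hp' hq (by push_cast; ring) (by norm_num)
  · exact comb _ _ p' q (-12) 1 hp' hq (by push_cast; ring) (by norm_num)
  · exact comb _ _ p' q 12 (-1) hp' hq (by push_cast; ring) (by norm_num)
  · exact comb _ _ p' q 1 0 hp' hq (by push_cast; ring) (by norm_num)
  · exact comb _ _ p' q 24 (-3) hp' hq (by push_cast; ring) (by norm_num)
  · exact comb _ _ p' q (-6) 1 hp' hq (by push_cast; ring) (by norm_num)

/-- The exponential sum of the squares over a window, through the sums over all roots and over the
roots divisible by three. -/
lemma norm_sum_sqKernel_window_le (m i : ℕ) (θ : ℝ) :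
    ‖∑ s ∈ Finset.Ico ((i * (6 * m)) ^ 2) (((i + 1) * (6 * m)) ^ 2),
        (sqKernel s : ℂ) * expChar (s * θ)‖ ≤
      2 * i * (6 * m) * (3 / 4 *
        ‖∑ n ∈ Finset.range (6 * m), expChar (((i * (6 * m) + n : ℕ) : ℝ) ^ 2 * θ)‖ +
        3 / 4 * ‖∑ n ∈ Finset.range (2 * m), expChar (((i * (2 * m) + n : ℕ) : ℝ) ^ 2 * (9 * θ))‖)
      + 2 * (6 * m : ℝ) ^ 2 := by
  have hsq : ∀ y n : ℕ, n ^ 2 < y ^ 2 ↔ n < y := fun y n =>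
    Nat.pow_lt_pow_iff_left (by norm_num)
  have hK : ∀ y : ℕ, ∑ s ∈ Finset.range (y ^ 2), (sqKernel s : ℂ) * expChar (s * θ) =
      ∑ n ∈ Finset.range y, ((2 * n * sqWeight n : ℝ) : ℂ) * expChar ((n : ℝ) ^ 2 * θ) := by
    intro y
    have := sum_isSquare_eq
      (fun s n => ((2 * n * sqWeight n : ℝ) : ℂ) * expChar (s * θ)) (hsq y)
    push_cast at this ⊢
    rw [← this]
    refine Finset.sum_congr rfl fun s _ => ?_
    unfold sqKernel
    split_ifs <;> simp
  have hle : (i * (6 * m)) ^ 2 ≤ ((i + 1) * (6 * m)) ^ 2 := by gcongr; omega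
  rw [Finset.sum_Ico_eq_sub _ hle, hK, hK, show (i + 1) * (6 * m) = i * (6 * m) + 6 * m by ring,
    Finset.sum_range_add, add_sub_cancel_left]
  set z : ℕ → ℂ := fun n => expChar (((i * (6 * m) + n : ℕ) : ℝ) ^ 2 * θ) with hz
  have e1 : ∑ n ∈ Finset.range (6 * m), ((2 * ((i * (6 * m) + n : ℕ) : ℝ) *
      sqWeight (i * (6 * m) + n) : ℝ) : ℂ) * expChar (((i * (6 * m) + n : ℕ) : ℝ) ^ 2 * θ) =
      ((2 * i * (6 * m) : ℝ) : ℂ) * ∑ n ∈ Finset.range (6 * m),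
        (sqWeight (i * (6 * m) + n) : ℂ) * z n +
      ∑ n ∈ Finset.range (6 * m), ((2 * n * sqWeight (i * (6 * m) + n) : ℝ) : ℂ) * z n := by
    rw [Finset.mul_sum, ← Finset.sum_add_distrib]
    refine Finset.sum_congr rfl fun n _ => ?_
    simp only [hz]
    push_cast; ring
  -- The weight is 3/4 plus 3/4 on multiples of 3; for n = 3k the phase n²θ is k²·9θ.
  have e2 : ∑ n ∈ Finset.range (6 * m), (sqWeight (i * (6 * m) + n) : ℂ) * z n =
      3 / 4 * ∑ n ∈ Finset.range (6 * m), z n +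
      3 / 4 * ∑ n ∈ Finset.range (2 * m),
        expChar (((i * (2 * m) + n : ℕ) : ℝ) ^ 2 * (9 * θ)) := by
    have h3 := sum_range_three_mul z (2 * m)
    have h4 : ∑ n ∈ Finset.range (2 * m), expChar (((i * (2 * m) + n : ℕ) : ℝ) ^ 2 * (9 * θ)) =
        ∑ k ∈ Finset.range (2 * m), z (3 * k) := by
      refine Finset.sum_congr rfl fun n _ => ?_
      simp only [hz]; congr 1; push_cast; ring
    rw [h4, ← h3, show 3 * (2 * m) = 6 * m by ring, Finset.mul_sum, Finset.mul_sum,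
      ← Finset.sum_add_distrib]
    refine Finset.sum_congr rfl fun n _ => ?_
    have : 3 ∣ i * (6 * m) + n ↔ 3 ∣ n := by
      rw [show i * (6 * m) = 3 * (2 * i * m) by ring]
      omega
    simp only [sqWeight, this]
    split_ifs <;> push_cast <;> ring
  have e3 : ‖∑ n ∈ Finset.range (6 * m), ((2 * n * sqWeight (i * (6 * m) + n) : ℝ) : ℂ) * z n‖ ≤
      2 * (6 * m : ℝ) ^ 2 := by
    have h1 : ∀ n ∈ Finset.range (6 * m),
        ‖((2 * n * sqWeight (i * (6 * m) + n) : ℝ) : ℂ) * z n‖ ≤ 3 * n := by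
      intro n _
      have := sqWeight_nonneg (i * (6 * m) + n)
      have := sqWeight_le (i * (6 * m) + n)
      rw [norm_mul, norm_expChar, mul_one, Complex.norm_real, Real.norm_eq_abs,
        abs_of_nonneg (by positivity)]
      have : (0 : ℝ) ≤ n := by positivity
      nlinarith
    refine (norm_sum_le _ _).trans ((Finset.sum_le_sum h1).trans ?_)
    rw [← Finset.mul_sum]
    have h2 := Finset.sum_range_id_mul_two (6 * m)
    have h3 : (∑ n ∈ Finset.range (6 * m), n) * 2 ≤ (6 * m) ^ 2 := by
      rw [h2, sq]; exact Nat.mul_le_mul_left _ (Nat.sub_le _ _)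
    have h4 : (∑ n ∈ Finset.range (6 * m), (n : ℝ)) * 2 ≤ (6 * (m : ℝ)) ^ 2 := by
      have := (Nat.cast_le (α := ℝ)).2 h3
      push_cast at this
      exact this
    have : (0 : ℝ) ≤ (6 * (m : ℝ)) ^ 2 := by positivity
    linarith
  rw [e1]
  refine (norm_add_le _ _).trans (add_le_add ?_ e3)
  rw [norm_mul, Complex.norm_real, Real.norm_eq_abs, abs_of_nonneg (by positivity), e2]
  gcongr
  refine (norm_add_le _ _).trans ?_
  rw [norm_mul, norm_mul]
  norm_num

set_option maxHeartbeats 1000000 in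
/-- The exponential sum of `sqKernel - sqModel` over the window between two consecutive squares of
multiples of `6m` is at most about half of the length of the window. -/
lemma norm_sum_window_le {δ : ℝ} (hδ : 0 < δ) (R : ℕ) :
    ∃ m₀ : ℕ, ∀ m : ℕ, m₀ ≤ m → ∀ i < R, ∀ θ : ℝ,
      ‖∑ s ∈ Finset.Ico ((i * (6 * m)) ^ 2) (((i + 1) * (6 * m)) ^ 2),
        ((sqKernel s - sqModel s : ℝ) : ℂ) * expChar (s * θ)‖ ≤
      (1 / 2 + δ) * ((2 * i + 1) * (6 * m : ℝ) ^ 2) + 3 * (6 * m : ℝ) ^ 2 := by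
  obtain ⟨C₄, hC₄, M₄, hM₄⟩ := quadratic_sum_bound 4 (by norm_num) (show 0 < δ / 4 by positivity)
  obtain ⟨C₉, hC₉, M₉, hM₉⟩ := quadratic_sum_bound 9 (by norm_num) (show 0 < δ / 4 by positivity)
  set C := max (max C₄ C₉) 1 with hC
  have hC1 : 1 ≤ C := le_max_right _ _
  have hC₄C : C₄ ≤ C := (le_max_left _ _).trans (le_max_left _ _)
  have hC₉C : C₉ ≤ C := (le_max_right _ _).trans (le_max_left _ _)
  have hCpos : 0 < C := by linarith
  set U : ℝ := 1 + 2 * Real.pi * (200 * C) * (6 * R) ^ 2 with hU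
  have hU0 : 0 < U := by positivity
  obtain ⟨m₁, hm₁⟩ := exists_nat_gt (1200 * (6 * R + 1) * U + 36 / (200 * C) + 72)
  refine ⟨max (max M₄ M₉) m₁ + 1, ?_⟩
  intro m hm i hi θ
  have hmM₄ : M₄ ≤ m := by have := le_max_left M₄ M₉; have := le_max_left (max M₄ M₉) m₁; omega
  have hmM₉ : M₉ ≤ m := by have := le_max_right M₄ M₉; have := le_max_left (max M₄ M₉) m₁; omega
  have hmm₁ : (m₁ : ℝ) ≤ m := by
    have := le_max_right (max M₄ M₉) m₁
    exact_mod_cast (by omega : m₁ ≤ m)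
  have hm1 : (1 : ℝ) ≤ m := by exact_mod_cast (by omega : 1 ≤ m)
  have hmpos : (0 : ℝ) < m := by linarith
  have hle : (i * (6 * m)) ^ 2 ≤ ((i + 1) * (6 * m)) ^ 2 := by gcongr; omega
  set ψ : ℝ := C / (m : ℝ) ^ 2 with hψ
  have hψ0 : 0 < ψ := by positivity
  have hi0 : (0 : ℝ) ≤ i := by positivity
  -- Near denominator 12, |η| times the summation range stays bounded as m grows, so a bound linear
  -- in m results, against windows of order m².
  by_cases hnear : ∃ p : ℤ, |12 * θ - p| ≤ 200 * ψ
  · obtain ⟨p, hp⟩ := hnear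
    set η := θ - p / 12 with hη
    have hθ : θ = p / 12 + η := by rw [hη]; ring
    have hη' : |η| ≤ 200 * ψ := by
      have : 12 * θ - p = 12 * η := by rw [hη]; ring
      rw [this, abs_mul, abs_of_pos (by norm_num : (0 : ℝ) < 12)] at hp
      have := abs_nonneg η
      linarith
    have hY : ∀ y ≤ R * (6 * m), ‖∑ s ∈ Finset.range (y ^ 2),
        ((sqKernel s - sqModel s : ℝ) : ℂ) * expChar (s * θ)‖ ≤ m * m := by
      intro y hy
      have hyR : (y : ℝ) ≤ R * (6 * m) := by exact_mod_cast hy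
      rw [hθ]
      refine (norm_sum_near_le p (B := 1200 * ((6 * R + 1) * m)) ?_).trans ?_
      · rw [Nat.sqrt_eq']
        nlinarith
      · have h1 : 2 * Real.pi * |η| * ((y ^ 2 : ℕ) : ℝ) ≤ 2 * Real.pi * (200 * C) * (6 * R) ^ 2 := by
          have : 2 * Real.pi * (200 * C) * (6 * R) ^ 2 =
              2 * Real.pi * (200 * ψ) * (R * (6 * m)) ^ 2 := by
            rw [hψ]; field_simp
          rw [this]; push_cast
          gcongr
        have h2 : 1200 * ((6 * R + 1) : ℝ) * U ≤ m := by
          have : 0 < 36 / (200 * C) := by positivity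
          linarith
        calc _ ≤ 1200 * ((6 * R + 1) * m) * U := by rw [hU]; gcongr
          _ = (1200 * ((6 * R + 1) : ℝ) * U) * m := by ring
          _ ≤ _ := by gcongr
    rw [Finset.sum_Ico_eq_sub _ hle]
    refine (norm_sub_le _ _).trans ?_
    have h1 := hY ((i + 1) * (6 * m)) (Nat.mul_le_mul_right _ hi)
    have h2 := hY (i * (6 * m)) (Nat.mul_le_mul_right _ hi.le)
    have h3 : 0 ≤ (1 / 2 + δ) * ((2 * i + 1) * (6 * m : ℝ) ^ 2) := by positivity
    nlinarith
  · push Not at hnear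
    obtain ⟨hfar, hor⟩ := far_from_fractions hψ0 hnear
    have hmod : ∀ Y : ℕ, ‖∑ s ∈ Finset.range Y, (sqModel s : ℂ) * expChar (s * θ)‖ ≤
        18 * (m : ℝ) ^ 2 := by
      intro Y
      refine (norm_sum_sqModel_le (κ := 200 * ψ) (by positivity) (fun p => (hnear p).le) Y).trans ?_
      have h1 : 18 / (200 * ψ) ≤ (m : ℝ) ^ 2 := by
        have : 18 / (200 * ψ) = 18 / (200 * C) * (m : ℝ) ^ 2 := by rw [hψ]; field_simp
        rw [this]
        have : 18 / (200 * C) ≤ 1 := by rw [div_le_one (by positivity)]; linarith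
        nlinarith [sq_nonneg (m : ℝ)]
      have h2 : (72 : ℝ) ≤ m := by
        have h3 : 0 < 36 / (200 * C) := by positivity
        have h4 : 0 < 1200 * (6 * (R : ℝ) + 1) * U := by positivity
        linarith
      nlinarith
    have hcast : ∀ (c : ℝ) (a : ℕ), c ≤ C → 1 ≤ a → c / (((a * m : ℕ) : ℝ)) ^ 2 ≤ ψ := by
      intro c a hc ha
      have ha' : (1 : ℝ) ≤ a := by exact_mod_cast ha
      rw [hψ]
      push_cast
      gcongr
      nlinarith
    have hsqrt : ∀ {x l L : ℝ}, 0 ≤ l → 0 ≤ L → x ^ 2 ≤ (l ^ 2 + δ / 4) * L ^ 2 → 1 / 4 ≤ l →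
        x ≤ (l + δ / 2) * L := by
      intro x l L hl hL hx hl4
      refine (abs_le_of_sq_le_sq' ?_ (by positivity)).2
      refine hx.trans ?_
      rw [mul_pow]
      gcongr
      nlinarith
    have hroots : 3 / 4 *
        ‖∑ n ∈ Finset.range (6 * m), expChar (((i * (6 * m) + n : ℕ) : ℝ) ^ 2 * θ)‖ +
        3 / 4 * ‖∑ n ∈ Finset.range (2 * m), expChar (((i * (2 * m) + n : ℕ) : ℝ) ^ 2 * (9 * θ))‖
        ≤ (1 / 2 + δ) * (6 * m) := by
      -- Both routes give 1/2: either 3/4·1/2 + 3/4·1/3·1/2 from q = 4 for both sums, or 3/4·1/3 +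
      -- 3/4·1/3 from q = 9 for the full sum and the trivial bound for multiples of 3.
      rcases hor with h9 | h8
      · have s1 := hM₄ (6 * m) (by omega) (i * (6 * m)) θ
          (fun j hj p => (hcast _ _ hC₄C (by norm_num)).trans_lt (hfar j hj p))
        have s2 := hM₄ (2 * m) (by omega) (i * (2 * m)) (9 * θ)
          (fun j hj p => (hcast _ _ hC₄C (by norm_num)).trans_lt (h9 j hj p))
        have t1 := hsqrt (l := 1 / 2) (L := ((6 * m : ℕ) : ℝ)) (by norm_num) (Nat.cast_nonneg _)
          (s1.trans (by norm_num)) (by norm_num)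
        have t2 := hsqrt (l := 1 / 2) (L := ((2 * m : ℕ) : ℝ)) (by norm_num) (Nat.cast_nonneg _)
          (s2.trans (by norm_num)) (by norm_num)
        push_cast at t1 t2 ⊢
        nlinarith
      · have s1 := hM₉ (6 * m) (by omega) (i * (6 * m)) θ
          (fun j hj p => (hcast _ _ hC₉C (by norm_num)).trans_lt (h8 j hj p))
        have t1 := hsqrt (l := 1 / 3) (L := ((6 * m : ℕ) : ℝ)) (by norm_num) (Nat.cast_nonneg _)
          (s1.trans (by norm_num)) (by norm_num)
        have t2 : ‖∑ n ∈ Finset.range (2 * m),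
            expChar (((i * (2 * m) + n : ℕ) : ℝ) ^ 2 * (9 * θ))‖ ≤ 2 * m := by
          refine (norm_sum_le _ _).trans ?_
          simp [norm_expChar]
        push_cast at t1 t2 ⊢
        nlinarith
    have e : ∑ s ∈ Finset.Ico ((i * (6 * m)) ^ 2) (((i + 1) * (6 * m)) ^ 2),
        ((sqKernel s - sqModel s : ℝ) : ℂ) * expChar (s * θ) =
        ∑ s ∈ Finset.Ico ((i * (6 * m)) ^ 2) (((i + 1) * (6 * m)) ^ 2),
          (sqKernel s : ℂ) * expChar (s * θ) -
        (∑ s ∈ Finset.range (((i + 1) * (6 * m)) ^ 2), (sqModel s : ℂ) * expChar (s * θ) -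
          ∑ s ∈ Finset.range ((i * (6 * m)) ^ 2), (sqModel s : ℂ) * expChar (s * θ)) := by
      rw [← Finset.sum_Ico_eq_sub _ hle, ← Finset.sum_sub_distrib]
      refine Finset.sum_congr rfl fun s _ => ?_
      push_cast; ring
    rw [e]
    refine (norm_sub_le _ _).trans ?_
    have h1 := norm_sum_sqKernel_window_le m i θ
    have h0 := mul_le_mul_of_nonneg_left hroots (by positivity : (0 : ℝ) ≤ 2 * i * (6 * m))
    have h2 := norm_sub_le
      (∑ s ∈ Finset.range (((i + 1) * (6 * m)) ^ 2), (sqModel s : ℂ) * expChar (s * θ))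
      (∑ s ∈ Finset.range ((i * (6 * m)) ^ 2), (sqModel s : ℂ) * expChar (s * θ))
    have h4 := hmod (((i + 1) * (6 * m)) ^ 2)
    have h5 := hmod ((i * (6 * m)) ^ 2)
    have h3 : 2 * i * (6 * m) * ((1 / 2 + δ) * (6 * m)) ≤
        (1 / 2 + δ) * ((2 * i + 1) * (6 * m : ℝ) ^ 2) := by
      have : 0 ≤ (1 / 2 + δ) * (6 * m : ℝ) ^ 2 := by positivity
      nlinarith
    linarith

/-! ### Decomposition into windows and the bilinear form. -/

lemma mem_window_iff {M : ℕ} (hM : 0 < M) (i s : ℕ) :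
    s ∈ Finset.Ico ((i * M) ^ 2) (((i + 1) * M) ^ 2) ↔ s.sqrt / M = i := by
  rw [Finset.mem_Ico, ← Nat.le_sqrt', ← not_le (a := ((i + 1) * M) ^ 2), ← Nat.le_sqrt',
    ← Nat.le_div_iff_mul_le hM, ← Nat.le_div_iff_mul_le hM]
  omega

/-- The total length of the windows meeting an interval of length `N`. -/
lemma sum_window_length_le {M R N a w : ℕ} (hM : 0 < M) (hw : ∀ i < R, (2 * i + 1) * M ^ 2 ≤ w)
    (J : Finset ℕ) (hJ : J ⊆ Finset.range R)
    (hmeet : ∀ i ∈ J, ∃ b ∈ Finset.Icc 1 N,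
      a + b ∈ Finset.Ico ((i * M) ^ 2) (((i + 1) * M) ^ 2)) :
    ∑ i ∈ J, (2 * i + 1) * M ^ 2 ≤ N + 2 * w := by
  have hlen : ∀ i, ((i + 1) * M) ^ 2 = (i * M) ^ 2 + (2 * i + 1) * M ^ 2 := fun i => by ring
  have h1 : ∑ i ∈ J, (2 * i + 1) * M ^ 2 =
      (J.biUnion fun i => Finset.Ico ((i * M) ^ 2) (((i + 1) * M) ^ 2)).card := by
    rw [Finset.card_biUnion]
    · refine Finset.sum_congr rfl fun i _ => ?_
      rw [Nat.card_Ico, hlen, Nat.add_sub_cancel_left]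
    · intro i _ j _ hij
      rw [Function.onFun, Finset.disjoint_left]
      intro s hs hs'
      rw [mem_window_iff hM] at hs hs'
      exact hij (hs.symm.trans hs')
  rw [h1]
  -- A window meeting a + [1, N] stays within w of that interval.
  refine (Finset.card_le_card (t := Finset.Ico (a - w) (a + N + w)) ?_).trans ?_
  · intro s hs
    rw [Finset.mem_biUnion] at hs
    obtain ⟨i, hi, hs⟩ := hs
    obtain ⟨b, hb, hab⟩ := hmeet i hi
    have h2 := hw i (Finset.mem_range.1 (hJ hi))
    have h3 := hlen i
    rw [Finset.mem_Ico] at hs hab ⊢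
    rw [Finset.mem_Icc] at hb
    omega
  · rw [Nat.card_Ico]; omega

lemma window_sum_weights_le {M R N a w : ℕ} {δ : ℝ} (hδ : 0 ≤ δ) (hM : 0 < M)
    (hw : ∀ i < R, (2 * i + 1) * M ^ 2 ≤ w)
    (J : Finset ℕ) (hJ : J ⊆ Finset.range R)
    (hmeet : ∀ i ∈ J, ∃ b ∈ Finset.Icc 1 N,
      a + b ∈ Finset.Ico ((i * M) ^ 2) (((i + 1) * M) ^ 2)) :
    ∑ i ∈ J, ((1 / 2 + δ) * ((2 * (i : ℝ) + 1) * (M : ℝ) ^ 2) + 3 * (M : ℝ) ^ 2) ≤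
      (1 / 2 + δ) * (N + 2 * w) + R * (3 * (M : ℝ) ^ 2) := by
  have h1 := sum_window_length_le hM hw J hJ hmeet
  have h2 : ∑ i ∈ J, ((2 * (i : ℝ) + 1) * (M : ℝ) ^ 2) ≤ (N : ℝ) + 2 * (w : ℝ) := by exact_mod_cast h1
  have h3 : (J.card : ℝ) ≤ R := by
    have := Finset.card_le_card hJ
    rw [Finset.card_range] at this
    exact_mod_cast this
  rw [Finset.sum_add_distrib, ← Finset.mul_sum, Finset.sum_const, nsmul_eq_mul]
  gcongr

/-- Decomposing a bilinear sum into windows. -/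
lemma abs_bilinear_le_of_windows {M R N w : ℕ} {δ : ℝ} (hδ : 0 ≤ δ) (hM : 0 < M)
    (hcover : 2 * N < (R * M) ^ 2) (hw : ∀ i < R, (2 * i + 1) * M ^ 2 ≤ w) (f g k : ℕ → ℝ)
    (hk : ∀ i < R, ∀ θ : ℝ, ‖∑ s ∈ Finset.Ico ((i * M) ^ 2) (((i + 1) * M) ^ 2),
        (k s : ℂ) * expChar (s * θ)‖ ≤
      (1 / 2 + δ) * ((2 * i + 1) * (M : ℝ) ^ 2) + 3 * (M : ℝ) ^ 2) :
    |∑ a ∈ Finset.Icc 1 N, ∑ b ∈ Finset.Icc 1 N, f a * g b * k (a + b)| ≤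
      ((1 / 2 + δ) * (N + 2 * w) + R * (3 * (M : ℝ) ^ 2)) / 2 *
        (∑ a ∈ Finset.Icc 1 N, f a ^ 2 + ∑ b ∈ Finset.Icc 1 N, g b ^ 2) := by
  classical
  set Λ : ℕ → ℝ := fun i => (1 / 2 + δ) * ((2 * i + 1) * (M : ℝ) ^ 2) + 3 * (M : ℝ) ^ 2 with hΛ
  set W : ℕ → Finset ℕ := fun i => Finset.Ico ((i * M) ^ 2) (((i + 1) * M) ^ 2) with hW
  set I := Finset.Icc 1 N with hI
  let meets : ℕ → ℕ → Prop := fun i a => ∃ b ∈ I, a + b ∈ W i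
  -- Truncating f and g to the points meeting window i leaves the window's sum unchanged, but each a
  -- is then charged only for the windows it meets, of total length about N instead of 2N.
  let r : (ℕ → ℝ) → ℕ → ℕ → ℝ := fun f i a => if meets i a then f a else 0
  have hsplit : ∑ a ∈ I, ∑ b ∈ I, f a * g b * k (a + b) = ∑ i ∈ Finset.range R,
      ∑ a ∈ I, ∑ b ∈ I, if a + b ∈ W i then r f i a * r g i b * k (a + b) else 0 := by
    symm
    rw [Finset.sum_comm]
    refine Finset.sum_congr rfl fun a ha => ?_
    rw [Finset.sum_comm]
    refine Finset.sum_congr rfl fun b hb => ?_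
    have e : ∀ i ∈ Finset.range R,
        (if a + b ∈ W i then r f i a * r g i b * k (a + b) else 0) =
        if (a + b).sqrt / M = i then f a * g b * k (a + b) else 0 := by
      intro i _
      have hiff := mem_window_iff hM i (a + b)
      by_cases hab : a + b ∈ W i
      · rw [if_pos hab, if_pos (hiff.1 hab)]
        have h1 : meets i a := ⟨b, hb, hab⟩
        have h2 : meets i b := ⟨a, ha, by rwa [add_comm]⟩
        simp only [r, if_pos h1, if_pos h2]
      · rw [if_neg hab, if_neg fun h => hab (hiff.2 h)]
    rw [Finset.sum_congr rfl e, Finset.sum_ite_eq, if_pos]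
    rw [Finset.mem_range, Nat.div_lt_iff_lt_mul hM, Nat.sqrt_lt']
    rw [hI, Finset.mem_Icc] at ha hb
    omega
  have hr : ∀ f : ℕ → ℝ, ∑ i ∈ Finset.range R, Λ i / 2 * ∑ a ∈ I, r f i a ^ 2 ≤
      ((1 / 2 + δ) * (N + 2 * w) + R * (3 * (M : ℝ) ^ 2)) / 2 * ∑ a ∈ I, f a ^ 2 := by
    intro f
    simp_rw [Finset.mul_sum]
    rw [Finset.sum_comm]
    refine Finset.sum_le_sum fun a _ => ?_
    have e : ∑ i ∈ Finset.range R, Λ i / 2 * r f i a ^ 2 =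
        (∑ i ∈ (Finset.range R).filter (fun i => meets i a), Λ i) / 2 * f a ^ 2 := by
      rw [Finset.sum_filter, Finset.sum_div, Finset.sum_mul]
      refine Finset.sum_congr rfl fun i _ => ?_
      simp only [r]
      split_ifs <;> simp
    rw [e]
    gcongr
    exact window_sum_weights_le hδ hM hw _ (Finset.filter_subset _ _)
      fun i hi => (Finset.mem_filter.1 hi).2
  rw [hsplit]
  refine (Finset.abs_sum_le_sum_abs _ _).trans ?_
  refine (Finset.sum_le_sum fun i hi => bilinear_sum_le I I (W i) (r f i) (r g i) k
    (hk i (Finset.mem_range.1 hi))).trans ?_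
  have h := add_le_add (hr f) (hr g)
  rw [← Finset.sum_add_distrib, ← mul_add] at h
  refine le_trans (le_of_eq (Finset.sum_congr rfl fun i _ => ?_)) h
  simp only [hΛ]
  ring

/-- The bilinear form attached to `sqKernel - sqModel` on `[1, N]` has norm at most `N / 2`, up to
a small error. -/
lemma abs_bilinear_sub_le {δ : ℝ} (hδ : 0 < δ) :
    ∃ N₀ : ℕ, ∀ N : ℕ, N₀ ≤ N → ∀ f g : ℕ → ℝ, (∀ a, |f a| ≤ 1) → (∀ a, |g a| ≤ 1) →
      |∑ a ∈ Finset.Icc 1 N, ∑ b ∈ Finset.Icc 1 N,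
          f a * g b * (sqKernel (a + b) - sqModel (a + b))| ≤
        N / 4 * (∑ a ∈ Finset.Icc 1 N, f a ^ 2 + ∑ b ∈ Finset.Icc 1 N, g b ^ 2) +
          δ * (N : ℝ) ^ 2 := by
  set δ₁ : ℝ := min (δ / 2) (1 / 2) with hδ₁
  have hδ₁0 : 0 < δ₁ := by rw [hδ₁]; positivity
  -- With M = 6m, the boundary and additive window terms total at most 7RM² ≤ 252N/R ≤ δN/2.
  obtain ⟨R, hR⟩ := exists_nat_gt (504 / δ + 1)
  have hR1 : (1 : ℝ) < R := by
    have : 0 < 504 / δ := by positivity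
    linarith
  have hR0 : (0 : ℝ) < R := by linarith
  have hRn : 0 < R := by exact_mod_cast hR0
  have hRδ : 504 ≤ δ * R := by
    have : 504 / δ ≤ R := by linarith
    rw [div_le_iff₀ hδ] at this; linarith
  obtain ⟨m₀, hm₀⟩ := norm_sum_window_le hδ₁0 R
  refine ⟨(R * (m₀ + 10)) ^ 2, ?_⟩
  intro N hN f g hf hg
  have hs : R * (m₀ + 10) ≤ N.sqrt := by rw [Nat.le_sqrt']; exact hN
  set m := N.sqrt / R with hm
  have hmm : m₀ + 10 ≤ m := by rw [hm, Nat.le_div_iff_mul_le hRn, mul_comm]; exact hs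
  have hmR : m * R ≤ N.sqrt := Nat.div_mul_le_self _ _
  have hmR2 : N.sqrt < (m + 1) * R := by
    have := Nat.lt_div_mul_add (a := N.sqrt) hRn
    rw [← hm] at this; linarith
  have hNs : N.sqrt ^ 2 ≤ N := Nat.sqrt_le' N
  have hNs2 : N < (N.sqrt + 1) ^ 2 := Nat.lt_succ_sqrt' N
  have hcover : 2 * N < (R * (6 * m)) ^ 2 := by
    have h1 : N.sqrt + 1 ≤ 2 * (m * R) := by nlinarith
    have h2 : (N.sqrt + 1) ^ 2 ≤ (2 * (m * R)) ^ 2 := Nat.pow_le_pow_left h1 2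
    nlinarith
  have hw : ∀ i < R, (2 * i + 1) * (6 * m) ^ 2 ≤ 2 * R * (6 * m) ^ 2 := by
    intro i hi
    gcongr; omega
  have h := abs_bilinear_le_of_windows hδ₁0.le (M := 6 * m) (by omega) hcover hw f g
    (fun s => sqKernel s - sqModel s) (fun i hi θ => by
      have := hm₀ m (by omega) i hi θ
      push_cast at this ⊢
      exact this)
  refine h.trans ?_
  have hM2 : R * ((6 * m : ℕ) : ℝ) ^ 2 ≤ 36 * N / R := by
    rw [le_div_iff₀ hR0]
    have : ((m : ℝ) * R) ^ 2 ≤ N := by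
      have : (m * R) ^ 2 ≤ N := (Nat.pow_le_pow_left hmR 2).trans hNs
      exact_mod_cast this
    push_cast
    nlinarith
  have hNR : 36 * N / R ≤ δ / 14 * N := by
    rw [div_le_iff₀ hR0]
    have : (0 : ℝ) ≤ N := by positivity
    nlinarith
  have hsq : ∀ f : ℕ → ℝ, (∀ a, |f a| ≤ 1) → ∑ a ∈ Finset.Icc 1 N, f a ^ 2 ≤ N := by
    intro f hf
    refine (Finset.sum_le_card_nsmul _ _ 1 fun a _ => ?_).trans (by simp)
    rw [← sq_abs]
    have := hf a
    have := abs_nonneg (f a)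
    nlinarith
  have hsf := hsq f hf
  have hsg := hsq g hg
  have hN0 : (0 : ℝ) ≤ N := by positivity
  have hδa : δ₁ ≤ δ / 2 := min_le_left _ _
  have hδb : δ₁ ≤ 1 / 2 := min_le_right _ _
  have hΛ : ((1 / 2 + δ₁) * (N + 2 * (2 * R * (6 * m) ^ 2 : ℕ)) +
      R * (3 * ((6 * m : ℕ) : ℝ) ^ 2)) / 2 ≤ N / 4 + δ / 2 * N := by
    push_cast at hM2 ⊢
    have : (1 / 2 + δ₁) * (2 * (2 * R * (6 * (m : ℝ)) ^ 2)) ≤ 1 * (2 * (2 * R * (6 * (m : ℝ)) ^ 2)) := by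
      gcongr; linarith
    nlinarith
  have hnn : 0 ≤ ∑ a ∈ Finset.Icc 1 N, f a ^ 2 + ∑ b ∈ Finset.Icc 1 N, g b ^ 2 := by positivity
  have := mul_le_mul_of_nonneg_right hΛ hnn
  have h5 : δ / 2 * N * (∑ a ∈ Finset.Icc 1 N, f a ^ 2 + ∑ b ∈ Finset.Icc 1 N, g b ^ 2) ≤
      δ / 2 * N * (2 * N) := by gcongr; linarith
  linarith

/-! ### Densities in residue classes and the weighted count. -/

/-- The density of `A` in a residue class modulo `12`. -/
noncomputable def classDensity (A : Finset ℕ) (L r : ℕ) : ℝ :=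
  ((A.filter (fun a => a % 12 = r)).card : ℝ) / L

lemma sum_mod_twelve (A : Finset ℕ) (φ : ℕ → ℝ) :
    ∑ a ∈ A, φ (a % 12) =
      ∑ r ∈ Finset.range 12, ((A.filter (fun a => a % 12 = r)).card : ℝ) * φ r := by
  rw [← Finset.sum_fiberwise_of_maps_to (t := Finset.range 12) (g := fun a => a % 12)
    (fun a _ => Finset.mem_range.2 (Nat.mod_lt _ (by norm_num)))]
  refine Finset.sum_congr rfl fun r _ => ?_
  rw [← nsmul_eq_mul, ← Finset.sum_const]
  refine Finset.sum_congr rfl fun a ha => ?_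
  rw [(Finset.mem_filter.1 ha).2]

lemma sum_Icc_mod_twelve (φ : ℕ → ℝ) (L : ℕ) :
    ∑ a ∈ Finset.Icc 1 (12 * L), φ (a % 12) = L * ∑ r ∈ Finset.range 12, φ r := by
  induction L with
  | zero => simp
  | succ L ih =>
    rw [show 12 * (L + 1) = 12 * L + 1 + 1 + 1 + 1 + 1 + 1 + 1 + 1 + 1 + 1 + 1 + 1 by ring]
    iterate 12 rw [Finset.sum_Icc_succ_top (by omega)]
    rw [ih]
    have h : ∀ j, (12 * L + j) % 12 = j % 12 := fun j => by omega
    simp only [add_assoc, h]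
    norm_num [Finset.sum_range_succ]
    ring

lemma card_class_eq (L r : ℕ) (hr : r < 12) :
    ((Finset.Icc 1 (12 * L)).filter (fun a => a % 12 = r)).card = L := by
  have h := sum_Icc_mod_twelve (fun s => if s = r then 1 else 0) L
  rw [Finset.sum_ite_eq' _ r, if_pos (Finset.mem_range.2 hr), mul_one, Finset.sum_boole] at h
  exact_mod_cast h

section

variable {A : Finset ℕ} {L : ℕ}

lemma classDensity_mem_Icc (hA : A ⊆ Finset.Icc 1 (12 * L)) (r : ℕ) :
    classDensity A L r ∈ Set.Icc (0 : ℝ) 1 := by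
  refine ⟨by unfold classDensity; positivity, ?_⟩
  unfold classDensity
  by_cases hr : r < 12
  · refine div_le_one_of_le₀ ?_ (Nat.cast_nonneg _)
    have := Finset.card_le_card (Finset.filter_subset_filter (fun a => a % 12 = r) hA)
    rw [card_class_eq L r hr] at this
    exact_mod_cast this
  · have : A.filter (fun a => a % 12 = r) = ∅ := by
      refine Finset.filter_eq_empty_iff.2 fun a _ => ?_
      omega
    rw [this]; simp

lemma card_class_eq_mul (hL : 0 < L) (r : ℕ) :
    ((A.filter (fun a => a % 12 = r)).card : ℝ) = L * classDensity A L r := by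
  have : (L : ℝ) ≠ 0 := by positivity
  unfold classDensity; field_simp

lemma sum_classDensity (hL : 0 < L) :
    L * ∑ r ∈ Finset.range 12, classDensity A L r = A.card := by
  have h := sum_mod_twelve A (fun _ => 1)
  simp only [card_class_eq_mul (A := A) hL, mul_one, Finset.sum_const, nsmul_eq_mul] at h
  rw [Finset.mul_sum, h]

/-- The indicator function of `A` minus its mean over residue classes. -/
noncomputable def balanced (A : Finset ℕ) (L a : ℕ) : ℝ :=
  (if a ∈ A then 1 else 0) - classDensity A L (a % 12)

lemma abs_balanced_le (hA : A ⊆ Finset.Icc 1 (12 * L)) (a : ℕ) : |balanced A L a| ≤ 1 := by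
  have h := classDensity_mem_Icc hA (a % 12)
  unfold balanced
  rw [abs_le]
  split_ifs <;> constructor <;> linarith [h.1, h.2]

lemma sum_sq_balanced (hL : 0 < L) (hA : A ⊆ Finset.Icc 1 (12 * L)) :
    ∑ a ∈ Finset.Icc 1 (12 * L), balanced A L a ^ 2 =
      L * ∑ r ∈ Finset.range 12, classDensity A L r * (1 - classDensity A L r) := by
  have e : ∀ a ∈ Finset.Icc 1 (12 * L), balanced A L a ^ 2 =
      (if a ∈ A then 1 - 2 * classDensity A L (a % 12) else 0) +
        classDensity A L (a % 12) ^ 2 := by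
    intro a _
    unfold balanced
    split_ifs <;> ring
  rw [Finset.sum_congr rfl e, Finset.sum_add_distrib,
    sum_Icc_mod_twelve (fun r => classDensity A L r ^ 2), ← Finset.sum_filter,
    Finset.filter_mem_eq_inter, Finset.inter_eq_right.2 hA,
    sum_mod_twelve A (fun r => 1 - 2 * classDensity A L r), Finset.mul_sum, Finset.mul_sum,
    ← Finset.sum_add_distrib]
  refine Finset.sum_congr rfl fun r _ => ?_
  rw [card_class_eq_mul hL]; ring

end

lemma sqModel_mod (a b : ℕ) : sqModel (a + b) = sqModel (a % 12 + b % 12) := by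
  unfold sqModel
  rw [Nat.add_mod a b 12]

/-- The main term, in terms of the densities in residue classes. -/
lemma sum_sqModel_eq {A B : Finset ℕ} {L : ℕ} (hL : 0 < L) :
    ∑ a ∈ A, ∑ b ∈ B, sqModel (a + b) = 3 * (L : ℝ) ^ 2 *
      ∑ r ∈ Finset.range 12, ∑ s ∈ Finset.range 12,
        if (r + s) % 12 ∈ ({0, 1, 4, 9} : Finset ℕ) then
          classDensity A L r * classDensity B L s else 0 := by
  rw [Finset.sum_congr rfl fun a _ => Finset.sum_congr rfl fun b _ => sqModel_mod a b]
  rw [sum_mod_twelve A (fun r => ∑ b ∈ B, sqModel (r + b % 12)), Finset.mul_sum]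
  refine Finset.sum_congr rfl fun r _ => ?_
  rw [sum_mod_twelve B (fun s => sqModel (r + s)), Finset.mul_sum, Finset.mul_sum]
  refine Finset.sum_congr rfl fun s _ => ?_
  rw [card_class_eq_mul hL, card_class_eq_mul hL]
  unfold sqModel
  split_ifs <;> ring

/-- A function depending on the residue class only is nearly orthogonal to
`sqKernel - sqModel`. -/
lemma abs_sum_periodic_le (φ : ℕ → ℝ) (hφ : ∀ r, |φ r| ≤ 1) {N b : ℕ} (hb : b ≤ N) :
    |∑ a ∈ Finset.Icc 1 N, φ (a % 12) * (sqKernel (a + b) - sqModel (a + b))| ≤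
      2400 * (((2 * N + 1).sqrt : ℝ) + 1) := by
  set u : ℕ → ℝ := fun s => sqKernel s - sqModel s with hu
  have hclass : ∀ r x, x ≤ 2 * N + 1 → |∑ s ∈ Finset.range x, if s % 12 = r then u s else 0| ≤
      100 * (((2 * N + 1).sqrt : ℝ) + 1) := by
    intro r x hx
    refine (abs_sum_class_sub_le r x).trans ?_
    have : x.sqrt ≤ (2 * N + 1).sqrt := Nat.sqrt_le_sqrt hx
    gcongr
  have h1 : ∑ a ∈ Finset.Icc 1 N, φ (a % 12) * u (a + b) =
      ∑ r ∈ Finset.range 12, φ r *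
        (∑ s ∈ Finset.range (N + b + 1), (if s % 12 = (r + b) % 12 then u s else 0) -
          ∑ s ∈ Finset.range (b + 1), (if s % 12 = (r + b) % 12 then u s else 0)) := by
    have h2 : ∀ r ∈ Finset.range 12,
        ∑ s ∈ Finset.range (N + b + 1), (if s % 12 = (r + b) % 12 then u s else 0) -
          ∑ s ∈ Finset.range (b + 1), (if s % 12 = (r + b) % 12 then u s else 0) =
        ∑ a ∈ Finset.Icc 1 N, if a % 12 = r then u (a + b) else 0 := by
      intro r hr
      rw [← Finset.sum_Ico_eq_sub _ (by omega)]
      have : Finset.Icc 1 N = Finset.Ico 1 (N + 1) := rfl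
      rw [this]
      have h3 := Finset.sum_Ico_add' (fun s => if s % 12 = (r + b) % 12 then u s else 0) 1 (N + 1) b
      rw [show N + b + 1 = N + 1 + b by ring, show b + 1 = 1 + b by ring, ← h3]
      refine Finset.sum_congr rfl fun a _ => ?_
      have hr' := Finset.mem_range.1 hr
      have : (a + b) % 12 = (r + b) % 12 ↔ a % 12 = r := by omega
      simp only [this]
    refine Eq.trans ?_ (Finset.sum_congr rfl fun r hr => congrArg (φ r * ·) (h2 r hr).symm)
    simp_rw [Finset.mul_sum]
    rw [Finset.sum_comm (s := Finset.range 12)]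
    refine Finset.sum_congr rfl fun a _ => ?_
    simp_rw [mul_ite, mul_zero]
    rw [Finset.sum_ite_eq, if_pos (Finset.mem_range.2 (Nat.mod_lt _ (by norm_num)))]
  change |∑ a ∈ Finset.Icc 1 N, φ (a % 12) * u (a + b)| ≤ _
  rw [h1]
  refine (Finset.abs_sum_le_sum_abs _ _).trans ((Finset.sum_le_card_nsmul _ _
    (200 * (((2 * N + 1).sqrt : ℝ) + 1)) ?_).trans (by simp; linarith))
  intro r _
  rw [abs_mul]
  have h3 := hclass ((r + b) % 12) (N + b + 1) (by omega)
  have h4 := hclass ((r + b) % 12) (b + 1) (by omega)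
  have h5 := abs_sub (∑ s ∈ Finset.range (N + b + 1), (if s % 12 = (r + b) % 12 then u s else 0))
    (∑ s ∈ Finset.range (b + 1), (if s % 12 = (r + b) % 12 then u s else 0))
  calc _ ≤ 1 * (200 * (((2 * N + 1).sqrt : ℝ) + 1)) :=
        mul_le_mul (hφ r) (by linarith) (abs_nonneg _) (by norm_num)
    _ = _ := one_mul _

lemma exists_sqrt_small {δ : ℝ} (hδ : 0 < δ) :
    ∃ N₀ : ℕ, ∀ N : ℕ, N₀ ≤ N → 2400 * (((2 * N + 1).sqrt : ℝ) + 1) ≤ δ * N := by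
  obtain ⟨N₀, hN₀⟩ := exists_nat_gt ((9600 / δ) ^ 2 + 1)
  refine ⟨N₀, fun N hN => ?_⟩
  have hNN : (N₀ : ℝ) ≤ N := by exact_mod_cast hN
  have hN1 : (9600 / δ) ^ 2 + 1 ≤ N := by linarith
  have h0 : 0 ≤ (9600 / δ) ^ 2 := by positivity
  set s := Real.sqrt N with hs
  have hs2 : s ^ 2 = N := Real.sq_sqrt (by positivity)
  have hs0 : 0 ≤ s := Real.sqrt_nonneg _
  have hs1 : 1 ≤ s := by rw [hs, Real.one_le_sqrt]; linarith
  have h1 : 9600 / δ ≤ s := by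
    rw [hs]; exact Real.le_sqrt_of_sq_le (by linarith)
  have h2 : 9600 ≤ δ * s := by rw [div_le_iff₀ hδ] at h1; linarith
  have h3 : ((2 * N + 1).sqrt : ℝ) ≤ 2 * s := by
    refine (abs_le_of_sq_le_sq' ?_ (by positivity)).2
    have : ((2 * N + 1).sqrt : ℝ) ^ 2 ≤ 2 * N + 1 := by exact_mod_cast Nat.sqrt_le' (2 * N + 1)
    rw [mul_pow, hs2]
    linarith
  rw [← hs2]
  nlinarith

/-- The weighted number of pairs in `A × B` with square sum is positive above density `3 / 8`. -/
lemma weighted_count_ge {ε : ℝ} (hε : 0 < ε) :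
    ∃ L₀ : ℕ, ∀ L : ℕ, L₀ ≤ L → ∀ A B : Finset ℕ,
      A ⊆ Finset.Icc 1 (12 * L) → B ⊆ Finset.Icc 1 (12 * L) →
      (3 / 8 + ε) * (12 * L : ℝ) ≤ A.card → (3 / 8 + ε) * (12 * L : ℝ) ≤ B.card →
      ε / 8 * (12 * L : ℝ) ^ 2 ≤ ∑ a ∈ A, ∑ b ∈ B, sqKernel (a + b) := by
  have hδ : 0 < ε / 32 := by positivity
  obtain ⟨N₁, hN₁⟩ := abs_bilinear_sub_le hδ
  obtain ⟨N₂, hN₂⟩ := exists_sqrt_small hδ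
  refine ⟨N₁ + N₂ + 1, ?_⟩
  intro L hL A B hA hB hAc hBc
  have hL0 : 0 < L := by omega
  have hLr : (0 : ℝ) < L := by exact_mod_cast hL0
  set N := 12 * L with hN
  have hNr : (N : ℝ) = 12 * L := by rw [hN]; push_cast; ring
  rw [← hNr] at hAc hBc ⊢
  set α := classDensity A L with hα
  set β := classDensity B L with hβ
  set f := balanced A L with hf
  set g := balanced B L with hg
  set u : ℕ → ℝ := fun s => sqKernel s - sqModel s with hu
  set I := Finset.Icc 1 N with hI
  have hbil := hN₁ N (by omega) f g (abs_balanced_le hA) (abs_balanced_le hB)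
  have hsm := hN₂ N (by omega)
  -- Here 12(3/8 + ε) = 9/2 + 12ε, so the finite inequality is used with t = 4ε.
  have hSα : 9 / 2 + 3 * (4 * ε) ≤ ∑ r ∈ Finset.range 12, α r := by
    have h := sum_classDensity (A := A) hL0
    rw [← hα] at h
    rw [← h, hNr] at hAc
    have : L * (9 / 2 + 3 * (4 * ε)) ≤ L * ∑ r ∈ Finset.range 12, α r := by linarith
    exact le_of_mul_le_mul_left this hLr
  have hSβ : 9 / 2 + 3 * (4 * ε) ≤ ∑ r ∈ Finset.range 12, β r := by
    have h := sum_classDensity (A := B) hL0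
    rw [← hβ] at h
    rw [← h, hNr] at hBc
    have : L * (9 / 2 + 3 * (4 * ε)) ≤ L * ∑ r ∈ Finset.range 12, β r := by linarith
    exact le_of_mul_le_mul_left this hLr
  have hfin := mod_twelve_bound α β (classDensity_mem_Icc hA) (classDensity_mem_Icc hB)
    (by positivity) hSα hSβ
  have hmain := sum_sqModel_eq (A := A) (B := B) hL0
  rw [sum_sq_balanced hL0 hA, sum_sq_balanced hL0 hB] at hbil
  -- Uses 1_A 1_B = fg + α1_B + fβ; the last two products have a periodic factor.
  have hdec : ∑ a ∈ A, ∑ b ∈ B, sqKernel (a + b) = ∑ a ∈ A, ∑ b ∈ B, sqModel (a + b) +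
      (∑ a ∈ I, ∑ b ∈ I, f a * g b * u (a + b)) +
      ∑ b ∈ I, (if b ∈ B then 1 else 0) * ∑ a ∈ I, α (a % 12) * u (a + b) +
      ∑ a ∈ I, f a * ∑ b ∈ I, β (b % 12) * u (b + a) := by
    have hind : ∀ (F : ℕ → ℕ → ℝ), ∑ a ∈ A, ∑ b ∈ B, F a b =
        ∑ a ∈ I, ∑ b ∈ I, (if a ∈ A then 1 else 0) * (if b ∈ B then 1 else 0) * F a b := by
      intro F
      have e : ∀ (X : Finset ℕ) (hX : X ⊆ I) (G : ℕ → ℝ),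
          ∑ a ∈ X, G a = ∑ a ∈ I, (if a ∈ X then 1 else 0) * G a := by
        intro X hX G
        simp_rw [ite_mul, one_mul, zero_mul]
        rw [← Finset.sum_filter, Finset.filter_mem_eq_inter, Finset.inter_eq_right.2 hX]
      rw [e A hA]
      refine Finset.sum_congr rfl fun a _ => ?_
      rw [e B hB, Finset.mul_sum]
      refine Finset.sum_congr rfl fun b _ => ?_
      ring
    rw [hind, hind]
    simp_rw [Finset.mul_sum]
    rw [Finset.sum_comm (f := fun b a => (if b ∈ B then 1 else 0) * (α (a % 12) * u (a + b))),
      ← Finset.sum_add_distrib, ← Finset.sum_add_distrib, ← Finset.sum_add_distrib]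
    refine Finset.sum_congr rfl fun a _ => ?_
    rw [← Finset.sum_add_distrib, ← Finset.sum_add_distrib, ← Finset.sum_add_distrib]
    refine Finset.sum_congr rfl fun b _ => ?_
    simp only [hf, hg, hu, hα, hβ, balanced, add_comm b a]
    ring
  have hα1 : ∀ r, |α r| ≤ 1 := fun r => by
    have := classDensity_mem_Icc hA r
    rw [abs_le]; exact ⟨by linarith [this.1], this.2⟩
  have hβ1 : ∀ r, |β r| ≤ 1 := fun r => by
    have := classDensity_mem_Icc hB r
    rw [abs_le]; exact ⟨by linarith [this.1], this.2⟩
  have hcross : ∀ (v φ : ℕ → ℝ), (∀ a, |v a| ≤ 1) → (∀ r, |φ r| ≤ 1) →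
      |∑ a ∈ I, v a * ∑ b ∈ I, φ (b % 12) * u (b + a)| ≤ ε / 32 * (N : ℝ) ^ 2 := by
    intro v φ hv hφ
    refine (Finset.abs_sum_le_sum_abs _ _).trans ((Finset.sum_le_card_nsmul _ _
      (ε / 32 * N) ?_).trans ?_)
    · intro a ha
      rw [abs_mul]
      have h1 := (abs_sum_periodic_le φ hφ (Finset.mem_Icc.1 ha).2).trans hsm
      calc _ ≤ 1 * (ε / 32 * N) := mul_le_mul (hv a) h1 (abs_nonneg _) (by norm_num)
        _ = _ := one_mul _
    · rw [hI, Nat.card_Icc, nsmul_eq_mul, Nat.add_sub_cancel]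
      exact le_of_eq (by ring)
  have hc1 := hcross (fun b => if b ∈ B then 1 else 0) α
    (fun b => by split_ifs <;> simp) hα1
  have hc2 := hcross f β (abs_balanced_le hA) hβ1
  rw [hdec, hmain]
  rw [abs_le] at hbil hc1 hc2
  -- As N/4 · L = 3L², main and spectral terms leave at least 3L²·12ε = εN²/4; three errors of
  -- εN²/32 keep this above εN²/8.
  have hL2 := mul_le_mul_of_nonneg_left hfin (by positivity : 0 ≤ 3 * (L : ℝ) ^ 2)
  rw [hNr] at *
  linarith [hbil.1, hc1.1, hc2.1]

lemma sqKernel_nonneg (s : ℕ) : 0 ≤ sqKernel s := by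
  unfold sqKernel
  split_ifs
  · have := sqWeight_nonneg s.sqrt
    positivity
  · exact le_rfl

lemma sqKernel_le {s N : ℕ} (hs : s ≤ 2 * N) :
    sqKernel s ≤ if IsSquare s then 9 / 2 * Real.sqrt N else 0 := by
  unfold sqKernel
  split_ifs with h
  · have h1 : (s.sqrt : ℝ) ≤ 3 / 2 * Real.sqrt N := by
      refine (abs_le_of_sq_le_sq' ?_ (by positivity)).2
      have h2 : (s.sqrt : ℝ) ^ 2 ≤ 2 * N := by exact_mod_cast (Nat.sqrt_le' s).trans hs
      rw [mul_pow, Real.sq_sqrt (Nat.cast_nonneg _)]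
      have : (0 : ℝ) ≤ N := Nat.cast_nonneg _
      linarith
    have h3 := sqWeight_le s.sqrt
    have h4 := sqWeight_nonneg s.sqrt
    have h5 : (0 : ℝ) ≤ s.sqrt := Nat.cast_nonneg _
    nlinarith
  · exact le_rfl

lemma card_inter_multiple_ge {A : Finset ℕ} {N : ℕ} (hA : A ⊆ Finset.Icc 1 N) :
    (A.card : ℝ) - 12 ≤ ((A ∩ Finset.Icc 1 (12 * (N / 12))).card : ℝ) := by
  have h : A ⊆ (A ∩ Finset.Icc 1 (12 * (N / 12))) ∪ Finset.Ioc (12 * (N / 12)) N := by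
    intro a ha
    have := Finset.mem_Icc.1 (hA ha)
    simp only [Finset.mem_union, Finset.mem_inter, Finset.mem_Icc, Finset.mem_Ioc, ha, true_and]
    omega
  have h1 := (Finset.card_le_card h).trans (Finset.card_union_le _ _)
  rw [Nat.card_Ioc] at h1
  have h2 : A.card ≤ (A ∩ Finset.Icc 1 (12 * (N / 12))).card + 12 := by omega
  have h3 : (A.card : ℝ) ≤ ((A ∩ Finset.Icc 1 (12 * (N / 12))).card : ℝ) + 12 := by
    exact_mod_cast h2
  linarith

/-- Two sets of density above `3 / 8` have many pairs whose sum is a square. -/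
lemma card_square_pairs_ge {ε : ℝ} (hε : 0 < ε) :
    ∃ N₀ : ℕ, ∀ N : ℕ, N₀ ≤ N → ∀ A B : Finset ℕ, A ⊆ Finset.Icc 1 N → B ⊆ Finset.Icc 1 N →
      (3 / 8 + ε) * (N : ℝ) ≤ A.card → (3 / 8 + ε) * (N : ℝ) ≤ B.card →
      ε / 144 * (N * Real.sqrt N) ≤
        (((A ×ˢ B).filter (fun p : ℕ × ℕ => IsSquare (p.1 + p.2))).card : ℝ) := by
  obtain ⟨L₀, hL₀⟩ := weighted_count_ge (half_pos hε)
  obtain ⟨N₁, hN₁⟩ := exists_nat_gt (24 / ε + 44)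
  refine ⟨N₁ + 12 * L₀, ?_⟩
  intro N hN A B hA hB hAc hBc
  have hNN : (N₁ : ℝ) ≤ N := by exact_mod_cast (by omega : N₁ ≤ N)
  have h24 : 0 < 24 / ε := by positivity
  have hN44 : (44 : ℝ) ≤ N := by linarith
  have hNε : 24 ≤ ε * N := by
    have : 24 / ε ≤ N := by linarith
    rw [div_le_iff₀ hε] at this; linarith
  set L := N / 12 with hL
  have hLN : (12 * L : ℝ) ≤ N := by exact_mod_cast (by omega : 12 * L ≤ N)
  have hLN2 : (N : ℝ) ≤ 12 * L + 12 := by exact_mod_cast (by omega : N ≤ 12 * L + 12)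
  -- Cutting N down to a multiple of 12 costs at most 12 elements, paid for by half of ε.
  have hdens : (3 / 8 + ε / 2) * (12 * L : ℝ) ≤ (3 / 8 + ε) * N - 12 := by nlinarith
  have hA' := card_inter_multiple_ge hA
  have hB' := card_inter_multiple_ge hB
  have hw := hL₀ L (by omega) (A ∩ Finset.Icc 1 (12 * L)) (B ∩ Finset.Icc 1 (12 * L))
    Finset.inter_subset_right Finset.inter_subset_right (by linarith) (by linarith)
  have hle : ∑ a ∈ A ∩ Finset.Icc 1 (12 * L), ∑ b ∈ B ∩ Finset.Icc 1 (12 * L), sqKernel (a + b) ≤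
      ∑ a ∈ A, ∑ b ∈ B, sqKernel (a + b) := by
    refine (Finset.sum_le_sum fun a _ => Finset.sum_le_sum_of_subset_of_nonneg
      Finset.inter_subset_left fun b _ _ => sqKernel_nonneg _).trans ?_
    exact Finset.sum_le_sum_of_subset_of_nonneg Finset.inter_subset_left
      fun a _ _ => Finset.sum_nonneg fun b _ => sqKernel_nonneg _
  set c : ℝ := (((A ×ˢ B).filter (fun p : ℕ × ℕ => IsSquare (p.1 + p.2))).card : ℝ) with hc
  have hcount : ∑ a ∈ A, ∑ b ∈ B, sqKernel (a + b) ≤ c * (9 / 2 * Real.sqrt N) := by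
    rw [← Finset.sum_product', hc, ← nsmul_eq_mul, ← Finset.sum_const, Finset.sum_filter]
    refine Finset.sum_le_sum fun p hp => ?_
    rw [Finset.mem_product] at hp
    have h1 := Finset.mem_Icc.1 (hA hp.1)
    have h2 := Finset.mem_Icc.1 (hB hp.2)
    exact sqKernel_le (by omega)
  have hs0 : 0 < Real.sqrt N := Real.sqrt_pos.2 (by linarith)
  have hs2 : Real.sqrt N * Real.sqrt N = N := Real.mul_self_sqrt (by linarith)
  have hsq : (N : ℝ) ^ 2 / 2 ≤ (12 * L : ℝ) ^ 2 := by nlinarith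
  have h5 : ε / 32 * (N : ℝ) ^ 2 ≤ c * (9 / 2 * Real.sqrt N) := by
    have : ε / 2 / 8 * ((N : ℝ) ^ 2 / 2) ≤ ε / 2 / 8 * (12 * L : ℝ) ^ 2 := by gcongr
    linarith
  have h6 : ε / 144 * (N * Real.sqrt N) * (9 / 2 * Real.sqrt N) ≤ c * (9 / 2 * Real.sqrt N) := by
    refine le_trans (le_of_eq ?_) h5
    calc _ = ε / 32 * (N * (Real.sqrt N * Real.sqrt N)) := by ring
      _ = _ := by rw [hs2]; ring
  exact le_of_mul_le_mul_right h6 (by positivity)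

/-! ### Sharpness and the final statement. -/

lemma card_filter_mod_eight (S : Finset ℕ) (K : ℕ) :
    ((Finset.Icc 1 (8 * K)).filter (fun a => a % 8 ∈ S)).card =
      K * ((Finset.range 8).filter (fun a => a ∈ S)).card := by
  induction K with
  | zero => simp
  | succ K ih =>
    simp only [Finset.card_filter] at ih ⊢
    rw [show 8 * (K + 1) = 8 * K + 1 + 1 + 1 + 1 + 1 + 1 + 1 + 1 by ring]
    iterate 8 rw [Finset.sum_Icc_succ_top (by omega)]
    rw [ih]
    have h : ∀ j, (8 * K + j) % 8 = j % 8 := fun j => by omega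
    simp only [add_assoc, h, Finset.sum_range_succ, Finset.sum_range_zero]
    norm_num
    ring

lemma card_three_classes_ge {S : Finset ℕ}
    (hS : ((Finset.range 8).filter (fun a => a ∈ S)).card = 3) {δ : ℝ} {N : ℕ}
    (hN : 3 ≤ δ * N) :
    (3 / 8 - δ) * (N : ℝ) ≤ (((Finset.Icc 1 N).filter (fun a => a % 8 ∈ S)).card : ℝ) := by
  have h1 : ((Finset.Icc 1 (8 * (N / 8))).filter (fun a => a % 8 ∈ S)).card ≤
      ((Finset.Icc 1 N).filter (fun a => a % 8 ∈ S)).card := by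
    refine Finset.card_le_card (Finset.filter_subset_filter _ ?_)
    exact Finset.Icc_subset_Icc_right (Nat.mul_div_le N 8)
  rw [card_filter_mod_eight, hS] at h1
  have h2 : 3 * N ≤ 8 * ((Finset.Icc 1 N).filter (fun a => a % 8 ∈ S)).card + 24 := by omega
  have h3 : (3 : ℝ) * N ≤ 8 * (((Finset.Icc 1 N).filter (fun a => a % 8 ∈ S)).card : ℝ) + 24 := by
    exact_mod_cast h2
  linarith

lemma sq_mod_eight (n : ℕ) : n * n % 8 = 0 ∨ n * n % 8 = 1 ∨ n * n % 8 = 4 := by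
  have h : n % 8 < 8 := Nat.mod_lt _ (by norm_num)
  rw [Nat.mul_mod]
  interval_cases n % 8 <;> simp

theorem theorem1p1 :
    (∀ ε : ℝ, 0 < ε → ∃ N₀ : ℕ, ∀ N : ℕ, N₀ ≤ N →
      ∀ A B : Finset ℕ, A ⊆ Finset.Icc 1 N → B ⊆ Finset.Icc 1 N →
        (3 / 8 + ε) * (N : ℝ) ≤ (A.card : ℝ) →
        (3 / 8 + ε) * (N : ℝ) ≤ (B.card : ℝ) →
        (∃ s ∈ A + B, IsSquare s) ∧
        (10 : ℝ) ^ (-6 : ℤ) * ε ^ 3 * (N : ℝ) ^ (3 / 2 : ℝ) ≤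
          (((A ×ˢ B).filter (fun p : ℕ × ℕ => IsSquare (p.1 + p.2))).card : ℝ)) ∧
    (∀ δ : ℝ, 0 < δ → ∃ N₀ : ℕ, ∀ N : ℕ, N₀ ≤ N →
      ∃ A B : Finset ℕ, A ⊆ Finset.Icc 1 N ∧ B ⊆ Finset.Icc 1 N ∧
        (3 / 8 - δ) * (N : ℝ) ≤ (A.card : ℝ) ∧
        (3 / 8 - δ) * (N : ℝ) ≤ (B.card : ℝ) ∧
        ∀ s ∈ A + B, ¬ IsSquare s) := by
  constructor
  · intro ε hε
    obtain ⟨N₀, hN₀⟩ := card_square_pairs_ge hε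
    refine ⟨N₀ + 1, fun N hN A B hA hB hAc hBc => ?_⟩
    have hcount := hN₀ N (by omega) A B hA hB hAc hBc
    have hNpos : (0 : ℝ) < N := by exact_mod_cast (by omega : 0 < N)
    -- Larger ε would force |A| > N; this gives ε³ ≤ ε, so the linear bound ε/144 suffices.
    have hε1 : ε ≤ 1 := by
      have h1 := Finset.card_le_card hA
      rw [Nat.card_Icc, Nat.add_sub_cancel] at h1
      have h2 : (A.card : ℝ) ≤ N := by exact_mod_cast h1
      by_contra hcon
      push Not at hcon
      nlinarith
    have hs : 0 < Real.sqrt N := Real.sqrt_pos.2 hNpos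
    constructor
    · have hpos : (0 : ℝ) <
          (((A ×ˢ B).filter (fun p : ℕ × ℕ => IsSquare (p.1 + p.2))).card : ℝ) :=
        lt_of_lt_of_le (by positivity) hcount
      obtain ⟨p, hp⟩ := Finset.card_pos.1 (Nat.cast_pos.1 hpos)
      rw [Finset.mem_filter, Finset.mem_product] at hp
      exact ⟨p.1 + p.2, Finset.add_mem_add hp.1.1 hp.1.2, hp.2⟩
    · refine le_trans ?_ hcount
      have hpow : (N : ℝ) ^ (3 / 2 : ℝ) = N * Real.sqrt N := by
        rw [Real.sqrt_eq_rpow, show (3 / 2 : ℝ) = 1 + 1 / 2 by norm_num, Real.rpow_add hNpos,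
          Real.rpow_one]
      rw [hpow]
      have h3 : ε ^ 3 ≤ ε := by
        have := pow_le_pow_of_le_one hε.le hε1 (show 1 ≤ 3 by norm_num)
        simpa using this
      have h4 : (10 : ℝ) ^ (-6 : ℤ) = 1 / 1000000 := by norm_num
      rw [h4]
      gcongr
      linarith
  · intro δ hδ
    obtain ⟨N₀, hN₀⟩ := exists_nat_gt (3 / δ)
    refine ⟨N₀, fun N hN => ?_⟩
    have hNδ : 3 ≤ δ * N := by
      have h1 : (N₀ : ℝ) ≤ N := by exact_mod_cast hN
      have : 3 / δ ≤ N := by linarith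
      rw [div_le_iff₀ hδ] at this; linarith
    -- The sums of these classes are 2, 3, 5, 6, 7 mod 8, avoiding the squares 0, 1, 4.
    refine ⟨(Finset.Icc 1 N).filter (fun a => a % 8 ∈ ({0, 4, 7} : Finset ℕ)),
      (Finset.Icc 1 N).filter (fun b => b % 8 ∈ ({3, 6, 7} : Finset ℕ)),
      Finset.filter_subset _ _, Finset.filter_subset _ _,
      card_three_classes_ge (by decide) hNδ, card_three_classes_ge (by decide) hNδ, ?_⟩
    intro s hs hsq
    obtain ⟨a, ha, b, hb, rfl⟩ := Finset.mem_add.1 hs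
    obtain ⟨n, hn⟩ := hsq
    have h1 := (Finset.mem_filter.1 ha).2
    have h2 := (Finset.mem_filter.1 hb).2
    have h3 := sq_mod_eight n
    rw [← hn] at h3
    simp only [Finset.mem_insert, Finset.mem_singleton] at h1 h2
    omega
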